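/- Let $M$ be a smooth manifold of dimension $n$ with a smooth pseudo-Riemannian metric $g$ (a smooth field of symmetric nondegenerate bilinear forms), Levi-Civita connection $\nabla$ and Ricci tensor $S(Y,Z)=\operatorname{tr}\big(X\mapsto R(X,Y)Z\big)$, where $R(X,Y)Z=\nabla_X\nabla_YZ-\nabla_Y\nabla_XZ-\nabla_{[X,Y]}Z$. Let $f,\lambda,\mu$ be smooth real functions on $M$, put $\xi=\mathrm{grad} f$ and $\mathrm{Hess}(f)(X,Y)=g(\nabla_X\xi,Y)$, and suppose that $$\mathrm{Hess}(f)+S+\lambda g+\mu\,df\otimes df=0$$ on $M$ (a gradient almost $\eta$-Ricci soliton with $\eta=df$). Write $|\xi|^2=g(\xi,\xi)$, $\Delta h=\operatorname{tr}\big(X\mapsto\nabla_X\mathrm{grad}\,h\big)$ for the Laplacian of a function $h$, and $|\nabla\xi|^2=\sum_{i,j}g^{ij}g(\nabla_{e_i}\xi,\nabla_{e_j}\xi)$, where $(e_i)$ is any local frame and $(g^{ij})$ is the inverse of the matrix $(g(e_i,e_j))$. Then at every point of $M$ $$\tfrac12(\Delta-\nabla_\xi)(|\xi|^2)=|\nabla\xi|^2+\lambda|\xi|^2+\mu|\xi|^2\big(|\xi|^2-2\Delta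 f\big)+(n-2)\,\xi(\lambda)-|\xi|^2\,\xi(\mu).$$ -/

import Mathlib

open Bundle FiberBundle VectorField
open scoped Manifold ContDiff

noncomputable section

section PseudoRiemannian

variable {E : Type*} [NormedAddCommGroup E] [NormedSpace ℝ E] [FiniteDimensional ℝ E]
  {H : Type*} [TopologicalSpace H] {I : ModelWithCorners ℝ E H}
  {M : Type*} [TopologicalSpace M] [ChartedSpace H M]

instance PseudoRiemannian.tangentSpace_finiteDimensional (x : M) : FiniteDimensional ℝ (TangentSpace I x) :=
  inferInstanceAs (FiniteDimensional ℝ E)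

instance PseudoRiemannian.tangentSpace_t2Space (x : M) : T2Space (TangentSpace I x) :=
  inferInstanceAs (T2Space E)

variable (I M) in
/-- A smooth pseudo-Riemannian metric on the manifold `M`: a smooth field of symmetric
nondegenerate bilinear forms on the tangent spaces. -/
structure PseudoRiemannianMetric [IsManifold I ∞ M] where
  /-- The bilinear form on the tangent space at `x`. -/
  val (x : M) : TangentSpace I x →L[ℝ] TangentSpace I x →L[ℝ] ℝ
  symm (x : M) (v w : TangentSpace I x) : val x v w = val x w v
  nondegenerate (x : M) (v : TangentSpace I x) : (∀ w, val x v w = 0) → v = 0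
  contMDiff : ContMDiff I (I.prod 𝓘(ℝ, E →L[ℝ] E →L[ℝ] ℝ)) ∞
    (fun x ↦ TotalSpace.mk' (E →L[ℝ] E →L[ℝ] ℝ) x (val x))

namespace PseudoRiemannianMetric

variable [IsManifold I ∞ M] (g : PseudoRiemannianMetric I M)

/-- The metric at `x` as a bilinear form on `T_x M`. -/
def bilin (x : M) : LinearMap.BilinForm ℝ (TangentSpace I x) :=
  ContinuousLinearMap.coeLM ℝ ∘ₗ (g.val x).toLinearMap

/-- The musical isomorphism `v ↦ g(v, ·)` from `T_x M` to its dual. -/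
def flat (x : M) : TangentSpace I x ≃ₗ[ℝ] Module.Dual ℝ (TangentSpace I x) :=
  LinearMap.linearEquivOfInjective
    (g.bilin x)
    ((injective_iff_map_eq_zero _).2 fun v hv ↦
      g.nondegenerate x v fun w ↦ LinearMap.congr_fun hv w)
    Subspace.dual_finrank_eq.symm

/-- The inverse musical isomorphism: `sharp x α` is the unique vector with
`g(sharp x α, w) = α w` for all `w`. -/
def sharp (x : M) : Module.Dual ℝ (TangentSpace I x) ≃ₗ[ℝ] TangentSpace I x :=
  (g.flat x).symm

theorem val_sharp (x : M) (α : Module.Dual ℝ (TangentSpace I x)) (w : TangentSpace I x) :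
    g.val x (g.sharp x α) w = α w :=
  LinearMap.congr_fun ((g.flat x).apply_symm_apply α) w

theorem sharp_eq_iff (x : M) (α : Module.Dual ℝ (TangentSpace I x)) (v : TangentSpace I x) :
    g.sharp x α = v ↔ ∀ w, g.val x v w = α w := by
  refine ⟨fun h w ↦ h ▸ g.val_sharp x α w, fun h ↦ ?_⟩
  refine sub_eq_zero.1 (g.nondegenerate x _ fun w ↦ ?_)
  simp [h, val_sharp]

theorem mdifferentiableAt_val {x : M} {X Y : Π x : M, TangentSpace I x}
    (hX : MDiffAt (T% X) x) (hY : MDiffAt (T% Y) x) :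
    MDiffAt (fun y ↦ g.val y (X y) (Y y)) x := by
  have : MDifferentiableAt I (I.prod 𝓘(ℝ))
      (fun m ↦ TotalSpace.mk' ℝ (E := Bundle.Trivial M ℝ) m (g.val m (X m) (Y m))) x := by
    apply MDifferentiableAt.clm_bundle_apply₂ (F₁ := E) (F₂ := E)
    · exact g.contMDiff.mdifferentiableAt (by simp)
    · exact hX
    · exact hY
  simp only [mdifferentiableAt_totalSpace] at this
  exact this.2

/-- The right-hand side of the Koszul formula
`2 g(∇_X Y, Z) = X g(Y,Z) + Y g(X,Z) - Z g(X,Y) + g([X,Y],Z) - g([X,Z],Y) - g([Y,Z],X)`. -/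
def koszul (X Y Z : Π x : M, TangentSpace I x) (x : M) : ℝ :=
  d% (fun y ↦ g.val y (Y y) (Z y)) x (X x) + d% (fun y ↦ g.val y (X y) (Z y)) x (Y x)
    - d% (fun y ↦ g.val y (X y) (Y y)) x (Z x)
    + g.val x (mlieBracket I X Y x) (Z x) - g.val x (mlieBracket I X Z x) (Y x)
    - g.val x (mlieBracket I Y Z x) (X x)

theorem koszul_tensorial_left {x : M} {Y Z : Π x : M, TangentSpace I x}
    (hY : MDiffAt (T% Y) x) (hZ : MDiffAt (T% Z) x) :
    TensorialAt I E (fun X ↦ (1 / 2 : ℝ) * g.koszul X Y Z x) x where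
  smul {f X} hf hX := by
    have h1 := mvfderiv_fun_mul hf (g.mdifferentiableAt_val hX hZ)
    have h2 := mvfderiv_fun_mul hf (g.mdifferentiableAt_val hX hY)
    simp [koszul, mlieBracket_smul_left hf hX, h1, h2]
    ring
  add {X X'} hX hX' := by
    have h1 := mvfderiv_fun_add (g.mdifferentiableAt_val hX hZ) (g.mdifferentiableAt_val hX' hZ)
    have h2 := mvfderiv_fun_add (g.mdifferentiableAt_val hX hY) (g.mdifferentiableAt_val hX' hY)
    simp [koszul, mlieBracket_add_left hX hX', h1, h2]
    ring

theorem koszul_tensorial_right {x : M} {X Y : Π x : M, TangentSpace I x}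
    (hX : MDiffAt (T% X) x) (hY : MDiffAt (T% Y) x) :
    TensorialAt I E (fun Z ↦ (1 / 2 : ℝ) * g.koszul X Y Z x) x where
  smul {f Z} hf hZ := by
    have h1 := mvfderiv_fun_mul hf (g.mdifferentiableAt_val hX hZ)
    have h2 := mvfderiv_fun_mul hf (g.mdifferentiableAt_val hY hZ)
    simp [koszul, mlieBracket_smul_right hf hZ, h1, h2]
    rw [g.symm x (Z x) (X x), g.symm x (Z x) (Y x)]
    ring
  add {Z Z'} hZ hZ' := by
    have h1 := mvfderiv_fun_add (g.mdifferentiableAt_val hX hZ) (g.mdifferentiableAt_val hX hZ')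
    have h2 := mvfderiv_fun_add (g.mdifferentiableAt_val hY hZ) (g.mdifferentiableAt_val hY hZ')
    simp [koszul, mlieBracket_add_right hZ hZ', h1, h2]
    ring

/-- For a vector field `Y` differentiable at `x`, the bilinear form `(v, w) ↦ g(∇_v Y, w)` on
`T_x M` given by the Koszul formula. -/
def koszulForm (Y : Π x : M, TangentSpace I x) (x : M) (hY : MDiffAt (T% Y) x) :
    TangentSpace I x →L[ℝ] TangentSpace I x →L[ℝ] ℝ :=
  TensorialAt.mkHom₂ (fun X Z ↦ (1 / 2 : ℝ) * g.koszul X Y Z x) x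
    (fun _ hZ ↦ g.koszul_tensorial_left hY hZ) (fun _ hX ↦ g.koszul_tensorial_right hX hY)

open Classical in
/-- The map `v ↦ ∇_v Y` on `T_x M`, with the value `0` if `Y` is not differentiable at `x`. -/
def leviCivitaFun (Y : Π x : M, TangentSpace I x) (x : M) :
    TangentSpace I x →L[ℝ] TangentSpace I x :=
  if hY : MDiffAt (T% Y) x then
    LinearMap.toContinuousLinearMap
      ((g.sharp x).toLinearMap ∘ₗ ContinuousLinearMap.coeLM ℝ ∘ₗ
        (g.koszulForm Y x hY).toLinearMap)
  else 0

/-- The Koszul formula. -/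
theorem val_leviCivitaFun {x : M} {X Y Z : Π x : M, TangentSpace I x}
    (hX : MDiffAt (T% X) x) (hY : MDiffAt (T% Y) x) (hZ : MDiffAt (T% Z) x) :
    g.val x (g.leviCivitaFun Y x (X x)) (Z x) = (1 / 2 : ℝ) * g.koszul X Y Z x := by
  rw [leviCivitaFun, dif_pos hY]
  refine (g.val_sharp x _ _).trans ?_
  exact TensorialAt.mkHom₂_apply
    (fun _ hZ ↦ g.koszul_tensorial_left hY hZ) (fun _ hX ↦ g.koszul_tensorial_right hX hY) hX hZ

theorem leviCivitaFun_eq_of_forall {x : M} {Y : Π x : M, TangentSpace I x}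
    {A : TangentSpace I x →L[ℝ] TangentSpace I x} (hY : MDiffAt (T% Y) x)
    (h : ∀ X Z : Π x : M, TangentSpace I x, MDiffAt (T% X) x → MDiffAt (T% Z) x →
      g.val x (A (X x)) (Z x) = (1 / 2 : ℝ) * g.koszul X Y Z x) :
    g.leviCivitaFun Y x = A := by
  ext v
  refine sub_eq_zero.1 (g.nondegenerate x _ fun w ↦ ?_)
  have hv := mdifferentiableAt_extend I E v
  have hw := mdifferentiableAt_extend I E w
  have h1 := h _ _ hv hw
  have h2 := g.val_leviCivitaFun hv hY hw
  simp only [extend_apply_self] at h1 h2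
  simp [h1, h2]

/-- The Levi-Civita connection of `g`, as a covariant derivative on the tangent bundle. -/
def leviCivita : CovariantDerivative I E (TangentSpace I : M → Type _) where
  toFun := g.leviCivitaFun
  isCovariantDerivativeOnUniv :=
    { add := fun {Y Y' x} hY hY' _ ↦ by
        refine g.leviCivitaFun_eq_of_forall (mdifferentiableAt_add_section hY hY') ?_
        intro X Z hX hZ
        have h1 := mvfderiv_fun_add (g.mdifferentiableAt_val hY hZ)
          (g.mdifferentiableAt_val hY' hZ)
        have h2 := mvfderiv_fun_add (g.mdifferentiableAt_val hX hY)
          (g.mdifferentiableAt_val hX hY')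
        have e1 := g.val_leviCivitaFun hX hY hZ
        have e2 := g.val_leviCivitaFun hX hY' hZ
        simp [e1, e2]
        simp [koszul, mlieBracket_add_left hY hY', mlieBracket_add_right hY hY', h1, h2]
        ring
      leibniz := fun {Y f x} hY hf _ ↦ by
        refine g.leviCivitaFun_eq_of_forall (hf.smul_section hY) ?_
        intro X Z hX hZ
        have h1 := mvfderiv_fun_mul hf (g.mdifferentiableAt_val hY hZ)
        have h2 := mvfderiv_fun_mul hf (g.mdifferentiableAt_val hX hY)
        have e1 := g.val_leviCivitaFun hX hY hZ
        simp [e1]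
        simp [koszul, mlieBracket_smul_left hf hY, mlieBracket_smul_right hf hY, h1, h2]
        rw [g.symm x (Y x) (X x), g.symm x (Y x) (Z x)]
        ring }

theorem val_leviCivita {x : M} {X Y Z : Π x : M, TangentSpace I x}
    (hX : MDiffAt (T% X) x) (hY : MDiffAt (T% Y) x) (hZ : MDiffAt (T% Z) x) :
    g.val x (g.leviCivita Y x (X x)) (Z x) = (1 / 2 : ℝ) * g.koszul X Y Z x :=
  g.val_leviCivitaFun hX hY hZ

/-- The Levi-Civita connection is torsion-free. -/
theorem leviCivita_torsion : g.leviCivita.torsion = 0 := by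
  rw [CovariantDerivative.torsion_eq_zero_iff]
  intro X Y x hX hY
  refine sub_eq_zero.1 (g.nondegenerate x _ fun w ↦ ?_)
  have hw := mdifferentiableAt_extend I E w
  have h1 := g.val_leviCivita hX hY hw
  have h2 := g.val_leviCivita hY hX hw
  have h3 : mlieBracket I Y X x = - mlieBracket I X Y x := mlieBracket_swap_apply
  have h4 : (fun y ↦ g.val y (Y y) (X y)) = fun y ↦ g.val y (X y) (Y y) :=
    funext fun y ↦ g.symm y _ _
  simp only [extend_apply_self] at h1 h2
  simp [h1, h2]
  simp [koszul, h3, h4]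
  ring

/-- The Levi-Civita connection is compatible with the metric:
`X g(Y, Z) = g(∇_X Y, Z) + g(Y, ∇_X Z)`. -/
theorem leviCivita_metric {x : M} {X Y Z : Π x : M, TangentSpace I x}
    (hX : MDiffAt (T% X) x) (hY : MDiffAt (T% Y) x) (hZ : MDiffAt (T% Z) x) :
    d% (fun y ↦ g.val y (Y y) (Z y)) x (X x) =
      g.val x (g.leviCivita Y x (X x)) (Z x) + g.val x (Y x) (g.leviCivita Z x (X x)) := by
  have h1 := g.val_leviCivita hX hY hZ
  have h2 := g.val_leviCivita hX hZ hY
  have h3 : mlieBracket I Z Y x = - mlieBracket I Y Z x := mlieBracket_swap_apply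
  have h4 : (fun y ↦ g.val y (Z y) (Y y)) = fun y ↦ g.val y (Y y) (Z y) :=
    funext fun y ↦ g.symm y _ _
  rw [g.symm x (Y x), h1, h2]
  simp [koszul, h3, h4]
  ring

/-- The gradient of a function: `g(grad f, ·) = df`. -/
def gradient (f : M → ℝ) (x : M) : TangentSpace I x :=
  g.sharp x (ContinuousLinearMap.coeLM ℝ (mvfderiv I f x))

/-- The squared length `|X|² = g(X, X)` of a vector field, as a function on `M`. -/
def normSq (X : Π x : M, TangentSpace I x) (x : M) : ℝ :=
  g.val x (X x) (X x)

/-- The Hessian `Hess f (v, w) = g(∇_v grad f, w)`. -/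
def hessian (f : M → ℝ) (x : M) (v w : TangentSpace I x) : ℝ :=
  g.val x (g.leviCivita (g.gradient f) x v) w

/-- The Laplacian `Δ f = div (grad f)`, the trace of `v ↦ ∇_v grad f`, which is the `g`-trace of
the Hessian of `f`. -/
def laplacian (f : M → ℝ) (x : M) : ℝ :=
  LinearMap.trace ℝ (TangentSpace I x) (g.leviCivita (g.gradient f) x).toLinearMap

/-- The trace with respect to `g` of a bilinear form `B` on `T_x M`: the trace of the endomorphism
`A` with `g(A v, w) = B(v, w)`; in a basis, `∑ gⁱʲ Bᵢⱼ`. -/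
def metricTrace (x : M) (B : LinearMap.BilinForm ℝ (TangentSpace I x)) : ℝ :=
  LinearMap.trace ℝ (TangentSpace I x) ((g.sharp x).toLinearMap ∘ₗ B)

/-- The squared norm `|A|²` with respect to `g` of an endomorphism `A` of `T_x M`: the `g`-trace of
`(v, w) ↦ g(A v, A w)`; in a basis, `∑ gⁱʲ g(A eᵢ, A eⱼ)`. -/
def endNormSq (x : M) (A : TangentSpace I x →L[ℝ] TangentSpace I x) : ℝ :=
  g.metricTrace x ((g.bilin x).compl₁₂ A.toLinearMap A.toLinearMap)

/-- The Riemann curvature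
`R(X, Y)Z = ∇_X ∇_Y Z - ∇_Y ∇_X Z - ∇_{[X, Y]} Z` on vector fields. -/
def curvature (X Y Z : Π x : M, TangentSpace I x) (x : M) : TangentSpace I x :=
  g.leviCivita (fun y ↦ g.leviCivita Z y (Y y)) x (X x)
    - g.leviCivita (fun y ↦ g.leviCivita Z y (X y)) x (Y x)
    - g.leviCivita Z x (mlieBracket I X Y x)

/-- The Ricci tensor `S(v, w)`, the trace of `u ↦ R(u, v)w` on `T_x M`, computed in a basis of
`T_x M`. The tangent vectors at `x` are extended to vector fields that are smooth near `x`; since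
the curvature is a tensor, the choice of extension does not matter. -/
def ricci (x : M) (v w : TangentSpace I x) : ℝ :=
  ∑ i, (Module.finBasis ℝ (TangentSpace I x)).coord i
    (g.curvature (extend E (Module.finBasis ℝ (TangentSpace I x) i)) (extend E v) (extend E w) x)

/-- `(g, grad f, lam, mu)` is a gradient almost `η`-Ricci soliton with `η = df`:
`f`, `lam`, `mu` are smooth functions with `Hess f + S + lam g + mu df ⊗ df = 0`. -/
structure IsGradientAlmostEtaRicciSoliton (f lam mu : M → ℝ) : Prop where
  contMDiff_potential : ContMDiff I 𝓘(ℝ, ℝ) ∞ f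
  contMDiff_lam : ContMDiff I 𝓘(ℝ, ℝ) ∞ lam
  contMDiff_mu : ContMDiff I 𝓘(ℝ, ℝ) ∞ mu
  equation (x : M) (v w : TangentSpace I x) :
    g.hessian f x v w + g.ricci x v w + lam x * g.val x v w
      + mu x * (mvfderiv I f x v * mvfderiv I f x w) = 0

end PseudoRiemannianMetric

end PseudoRiemannian

end

/-!
The identity combines two formulas for `ξ = grad f`. The Bochner formula
`½ Δ|ξ|² = |∇ξ|² + S(ξ, ξ) + ξ(Δf)` (`bochner`) holds for every smooth `f`. The soliton equation
enters through its divergence, which is `mvfderiv_laplacian`: by the contracted second Bianchi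
identity `dr = 2 div S` (`mvfderiv_sum_ricci`), with `r` known from the trace of the soliton
equation (`sum_ricci_eq`) and `div S` from its divergence, `ξ(Δf)` is a combination of `S(ξ, ξ)`,
`ξ(λ)`, `ξ(μ)` and `μ |ξ|² Δf`. Finally the soliton equation at `(ξ, ξ)` eliminates `S(ξ, ξ)`, and
`g(∇_ξ ξ, ξ) = ½ ξ(|ξ|²)`.

All traces are computed in synchronous frames: a frame `c i` near `x` and its dual frame `c' i`
with respect to `g`, both with vanishing covariant derivative at `x`
(`exists_isSynchronousFrame`). A trace is then `∑ i, g(A (c i), c' i)` near `x`, and is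
differentiated at `x` term by term without correction terms. The second Bianchi identity is needed
only for fields with vanishing covariant derivative at `x`, where all bracket terms drop out.

That the curvature is a tensor, which makes the Ricci tensor of a frame independent of the
extensions in its definition, follows from the pair symmetry `g(R(X, Y)Z, V) = g(R(Z, V)X, Y)`:
its two sides together with the skew symmetries exhibit the dependence on the value of each argument
at the point alone. The pair symmetry in turn rests on the first Bianchi identity, hence on the
Jacobi identity for vector fields.

A field that is `C^∞` at `x` in the sense of `ContMDiffAt` need not be `C^∞` at nearby points, so
smoothness near `x` is expressed as `∀ᶠ y in 𝓝 x, ContMDiffAt … y`.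
-/

/-! ### Derivatives along vector fields and the Lie bracket -/

section VectorFieldCalculus

open Filter Topology

set_option linter.unusedSectionVars false

variable {E : Type*} [NormedAddCommGroup E] [NormedSpace ℝ E]
  {M : Type*} [TopologicalSpace M] [ChartedSpace E M] [IsManifold 𝓘(ℝ, E) ∞ M]
  {X Y Z : Π x : M, TangentSpace 𝓘(ℝ, E) x} {f : M → ℝ} {x : M}

theorem ContMDiffAt.mdifferentiableAt_of_smooth (hX : CMDiffAt ∞ (T% X) x) : MDiffAt (T% X) x :=
  hX.mdifferentiableAt (by simp)

/-- A vector field smooth at `x` is differentiable at all points near `x`. -/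
theorem ContMDiffAt.eventually_mdifferentiableAt (hX : CMDiffAt ∞ (T% X) x) :
    ∀ᶠ y in 𝓝 x, MDiffAt (T% X) y :=
  ((contMDiffAt_iff_contMDiffAt_nhds (n := 1) (by simp)).1 (hX.of_le (by norm_cast))).mono
    fun _ h ↦ h.mdifferentiableAt (by simp)

/-- A function smooth at `x` is differentiable at all points near `x`. -/
theorem ContMDiffAt.eventually_mdifferentiableAt_fun (hf : CMDiffAt ∞ f x) :
    ∀ᶠ y in 𝓝 x, MDiffAt f y :=
  ((contMDiffAt_iff_contMDiffAt_nhds (n := 1) (by simp)).1 (hf.of_le (by norm_cast))).mono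
    fun _ h ↦ h.mdifferentiableAt (by simp)

/-- The derivative of a smooth function along a smooth vector field is smooth. -/
theorem ContMDiffAt.mvfderiv_apply (hf : CMDiffAt ∞ f x) (hX : CMDiffAt ∞ (T% X) x) :
    CMDiffAt ∞ (fun y ↦ mvfderiv 𝓘(ℝ, E) f y (X y)) x := by
  have h1 := hf.mfderiv_const (m := ∞) (by simp)
  have h2 := ContMDiffAt.clm_apply_of_inCoordinates (F₁ := E) (F₂ := ℝ)
    (E₁ := (TangentSpace 𝓘(ℝ, E) : M → Type _)) (E₂ := (TangentSpace 𝓘(ℝ, ℝ) : ℝ → Type _))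
    (b₁ := id) (b₂ := f) (ϕ := mfderiv 𝓘(ℝ, E) 𝓘(ℝ, ℝ) f) (v := X) h1 hX hf
  exact (contMDiff_snd_tangentBundle_modelSpace ℝ 𝓘(ℝ, ℝ)).contMDiffAt.comp x h2

/-- The Lie bracket of smooth vector fields is smooth. -/
theorem ContMDiffAt.mlieBracket_of_smooth [CompleteSpace E]
    (hX : CMDiffAt ∞ (T% X) x) (hY : CMDiffAt ∞ (T% Y) x) :
    CMDiffAt ∞ (T% (mlieBracket 𝓘(ℝ, E) X Y)) x := by
  have : IsManifold 𝓘(ℝ, E) (minSmoothness ℝ 2) M :=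
    .of_le (n := ∞) (by simp; norm_cast)
  have : IsManifold 𝓘(ℝ, E) (((⊤ : ℕ∞) : WithTop ℕ∞) + 1) M := by simpa
  exact ContMDiffAt.mlieBracket_vectorField (m := ⊤) (n := ⊤) hX hY (by simp)

theorem mvfderiv_congr_of_eventuallyEq {f₁ f₂ : M → ℝ} (h : ∀ᶠ y in 𝓝 x, f₁ y = f₂ y) :
    mvfderiv 𝓘(ℝ, E) f₁ x = mvfderiv 𝓘(ℝ, E) f₂ x := by
  have h' : f₁ =ᶠ[𝓝 x] f₂ := h
  rw [mvfderiv, mvfderiv, h'.mfderiv_eq]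
  rfl

/-- The derivative of a function, computed in the chart at `x`. -/
theorem mvfderiv_eq_fderiv_extChartAt {y : M} (hy : y ∈ (extChartAt 𝓘(ℝ, E) x).source)
    (hf : MDiffAt f y) (v : TangentSpace 𝓘(ℝ, E) y) :
    mvfderiv 𝓘(ℝ, E) f y v =
      fderiv ℝ (f ∘ (extChartAt 𝓘(ℝ, E) x).symm) (extChartAt 𝓘(ℝ, E) x y)
        (mfderiv 𝓘(ℝ, E) 𝓘(ℝ, E) (extChartAt 𝓘(ℝ, E) x) y v) := by
  have hsymm : MDiffAt (extChartAt 𝓘(ℝ, E) x).symm (extChartAt 𝓘(ℝ, E) x y) := by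
    have := mdifferentiableWithinAt_extChartAt_symm (I := 𝓘(ℝ, E))
      ((extChartAt 𝓘(ℝ, E) x).map_source hy)
    simpa [mdifferentiableWithinAt_univ] using this
  have hl := (extChartAt 𝓘(ℝ, E) x).left_inv hy
  have h2 := mfderiv_comp_apply_of_eq (I'' := 𝓘(ℝ, ℝ)) (x := extChartAt 𝓘(ℝ, E) x y) hf hsymm hl
    (mfderiv 𝓘(ℝ, E) 𝓘(ℝ, E) (extChartAt 𝓘(ℝ, E) x) y v)
  have h3 := mfderivWithin_extChartAt_symm_comp_mfderiv_extChartAt' (I := 𝓘(ℝ, E)) hy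
  have h4 := DFunLike.congr_fun h3 v
  simp only [modelWithCornersSelf_coe, Set.range_id, mfderivWithin_univ] at h4
  rw [← mfderiv_eq_fderiv]
  refine Eq.trans ?_ h2.symm
  exact congrArg (mfderiv 𝓘(ℝ, E) 𝓘(ℝ, ℝ) f y) h4.symm

/-- The Lie bracket acts on functions as the commutator of derivations. -/
theorem mvfderiv_mlieBracket [CompleteSpace E] (hf : CMDiffAt ∞ f x) (hX : CMDiffAt ∞ (T% X) x)
    (hY : CMDiffAt ∞ (T% Y) x) :
    mvfderiv 𝓘(ℝ, E) f x (mlieBracket 𝓘(ℝ, E) X Y x) =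
      mvfderiv 𝓘(ℝ, E) (fun y ↦ mvfderiv 𝓘(ℝ, E) f y (Y y)) x (X x)
        - mvfderiv 𝓘(ℝ, E) (fun y ↦ mvfderiv 𝓘(ℝ, E) f y (X y)) x (Y x) := by
  set φ := extChartAt 𝓘(ℝ, E) x with hφ
  have hxs : x ∈ φ.source := mem_extChartAt_source x
  -- The representatives of `f` and of a vector field `V` in the chart at `x`.
  let F : E → ℝ := f ∘ φ.symm
  let rep (V : Π x : M, TangentSpace 𝓘(ℝ, E) x) : E → E :=
    mpullbackWithin 𝓘(ℝ, E) 𝓘(ℝ, E) φ.symm V (Set.range 𝓘(ℝ, E))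
  have hF : ContDiffAt ℝ 2 F (φ x) := by
    have := (contMDiffAt_iff.1 (hf.of_le (m := 2) (by norm_cast))).2
    simpa only [extChartAt_model_space_eq_id, PartialEquiv.refl_coe, Function.id_comp,
      modelWithCornersSelf_coe, Set.range_id, contDiffWithinAt_univ] using this
  have hrep {V : Π x : M, TangentSpace 𝓘(ℝ, E) x} (hV : CMDiffAt ∞ (T% V) x) :
      DifferentiableAt ℝ (rep V) (φ x) := by
    have h1 := contMDiffWithinAt_mpullbackWithin_extChartAt_symm (n := ∞) (m := 1)
      (hV.contMDiffWithinAt (s := Set.univ) |>.of_le (by norm_cast)) uniqueMDiffOn_univ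
      (Set.mem_univ x) (by norm_cast)
    have h2 := contMDiffWithinAt_vectorSpace_iff_contDiffWithinAt.1 h1
    refine ((h2.contDiffAt ?_).differentiableAt (by simp))
    simpa only [Set.preimage_univ, Set.inter_univ] using
      extChartAt_target_mem_nhds (I := 𝓘(ℝ, E)) x
  have hval (V : Π x : M, TangentSpace 𝓘(ℝ, E) x) {y : M} (hy : y ∈ φ.source) :
      mfderiv 𝓘(ℝ, E) 𝓘(ℝ, E) φ y (V y) = rep V (φ y) := by
    have h1 := mfderiv_extChartAt_comp_mfderivWithin_extChartAt_symm' (I := 𝓘(ℝ, E)) hy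
    have h2 := mfderivWithin_extChartAt_symm_comp_mfderiv_extChartAt' (I := 𝓘(ℝ, E)) hy
    have h3 := ContinuousLinearMap.inverse_eq h2 h1
    have h4 : φ.symm (φ y) = y := φ.left_inv hy
    have h5 : (V (φ.symm (φ y)) : E) = V y := by rw [h4]
    exact (DFunLike.congr_fun h3 (V y)).symm.trans
      (congrArg (mfderiv[Set.range 𝓘(ℝ, E)] φ.symm (φ y)).inverse h5.symm)
  have hder {h : M → ℝ} {H : E → ℝ} (hh : CMDiffAt ∞ h x) (hH : h ∘ φ.symm =ᶠ[𝓝 (φ x)] H)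
      (V : Π x : M, TangentSpace 𝓘(ℝ, E) x) :
      mvfderiv 𝓘(ℝ, E) h x (V x) = fderiv ℝ H (φ x) (rep V (φ x)) := by
    rw [mvfderiv_eq_fderiv_extChartAt hxs (hh.mdifferentiableAt (by simp)), hval V hxs,
      hH.fderiv_eq]
  have hfun {V : Π x : M, TangentSpace 𝓘(ℝ, E) x} :
      (fun y ↦ mvfderiv 𝓘(ℝ, E) f y (V y)) ∘ φ.symm =ᶠ[𝓝 (φ x)]
        fun u ↦ fderiv ℝ F u (rep V u) := by
    have hc : ContinuousAt φ.symm (φ x) := continuousAt_extChartAt_symm x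
    have h1 : ∀ᶠ u in 𝓝 (φ x), MDiffAt f (φ.symm u) :=
      hc.eventually (by simpa [hφ] using hf.eventually_mdifferentiableAt_fun)
    filter_upwards [h1, extChartAt_target_mem_nhds (I := 𝓘(ℝ, E)) x] with u hu hut
    have hus := φ.map_target hut
    simp only [Function.comp_apply]
    rw [mvfderiv_eq_fderiv_extChartAt hus hu, hval V hus]
    rw [← hφ, φ.right_inv hut]
  rw [hder (hf.mvfderiv_apply hY) hfun, hder (hf.mvfderiv_apply hX) hfun,
    ← fderiv_apply_lieBracket hF (by simp) (hrep hY) (hrep hX),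
    mvfderiv_eq_fderiv_extChartAt hxs (hf.mdifferentiableAt (by simp))]
  congr 1
  have hs : φ.symm ⁻¹' Set.univ ∩ Set.range 𝓘(ℝ, E) = Set.univ := by simp
  rw [mlieBracket, mlieBracketWithin_apply, ← hφ, hs]
  refine Eq.trans ?_ (congrFun (lieBracketWithin_univ (𝕜 := ℝ) (V := rep X) (W := rep Y)) (φ x))
  exact (isInvertible_mfderiv_extChartAt (I := 𝓘(ℝ, E)) hxs).self_apply_inverse _

end VectorFieldCalculus

noncomputable section

namespace PseudoRiemannianMetric

open Filter Topology

set_option linter.unusedSectionVars false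

variable {E : Type*} [NormedAddCommGroup E] [NormedSpace ℝ E] [FiniteDimensional ℝ E]
  {M : Type*} [TopologicalSpace M] [ChartedSpace E M] [IsManifold 𝓘(ℝ, E) ∞ M]
  (g : PseudoRiemannianMetric 𝓘(ℝ, E) M)
  {X Y Z V W : Π x : M, TangentSpace 𝓘(ℝ, E) x} {f : M → ℝ} {x : M}

theorem contMDiffAt_val (hX : CMDiffAt ∞ (T% X) x) (hY : CMDiffAt ∞ (T% Y) x) :
    CMDiffAt ∞ (fun y ↦ g.val y (X y) (Y y)) x := by
  have : ContMDiffAt 𝓘(ℝ, E) (𝓘(ℝ, E).prod 𝓘(ℝ)) ∞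
      (fun m ↦ TotalSpace.mk' ℝ (E := Bundle.Trivial M ℝ) m (g.val m (X m) (Y m))) x :=
    ContMDiffAt.clm_bundle_apply₂ (F₁ := E) (F₂ := E) g.contMDiff.contMDiffAt hX hY
  simp only [contMDiffAt_totalSpace] at this
  exact this.2

theorem ext_val {v w : TangentSpace 𝓘(ℝ, E) x} (h : ∀ u, g.val x v u = g.val x w u) : v = w :=
  sub_eq_zero.1 (g.nondegenerate x _ fun u ↦ by simp [h])

/-! ### Dual frames -/

/-- Two families of vectors of `T_x M`, as many as the dimension of `M`, that are dual to each
other with respect to `g`. Both are then bases. -/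
structure IsDualPair {ι : Type*} [Fintype ι] [DecidableEq ι] (x : M)
    (u u' : ι → TangentSpace 𝓘(ℝ, E) x) : Prop where
  card : Fintype.card ι = Module.finrank ℝ E
  val_eq (i j : ι) : g.val x (u i) (u' j) = if i = j then 1 else 0

namespace IsDualPair

variable {g} {ι : Type*} [Fintype ι] [DecidableEq ι] {u u' : ι → TangentSpace 𝓘(ℝ, E) x}

theorem symm (h : g.IsDualPair x u u') : g.IsDualPair x u' u where
  card := h.card
  val_eq i j := by rw [g.symm, h.val_eq]; simp [eq_comm]

theorem linearIndependent (h : g.IsDualPair x u u') : LinearIndependent ℝ u := by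
  rw [Fintype.linearIndependent_iff]
  intro a ha j
  have := congrArg (fun w ↦ g.val x w (u' j)) ha
  simpa [h.val_eq] using this

/-- The first family of a dual pair, as a basis. The coordinate of `v` at `i` is `g(v, u' i)`. -/
def basis (h : g.IsDualPair x u u') : Module.Basis ι ℝ (TangentSpace 𝓘(ℝ, E) x) :=
  .mk h.linearIndependent (h.linearIndependent.span_eq_top_of_card_eq_finrank' h.card).ge

theorem basis_apply (h : g.IsDualPair x u u') (i : ι) : h.basis i = u i :=
  Module.Basis.mk_apply ..

theorem basis_repr (h : g.IsDualPair x u u') (v : TangentSpace 𝓘(ℝ, E) x) (i : ι) :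
    h.basis.repr v i = g.val x v (u' i) := by
  conv_rhs => rw [← h.basis.sum_repr v]
  simp [basis_apply, h.val_eq]

theorem sum_repr (h : g.IsDualPair x u u') (v : TangentSpace 𝓘(ℝ, E) x) :
    ∑ i, g.val x v (u' i) • u i = v := by
  conv_rhs => rw [← h.basis.sum_repr v]
  simp [basis_apply, h.basis_repr]

theorem val_eq_sum (h : g.IsDualPair x u u') (v w : TangentSpace 𝓘(ℝ, E) x) :
    g.val x v w = ∑ i, g.val x v (u' i) * g.val x (u i) w := by
  conv_lhs => rw [← h.sum_repr v]
  simp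

theorem trace_eq (h : g.IsDualPair x u u')
    (A : TangentSpace 𝓘(ℝ, E) x →ₗ[ℝ] TangentSpace 𝓘(ℝ, E) x) :
    LinearMap.trace ℝ _ A = ∑ i, g.val x (A (u i)) (u' i) := by
  rw [LinearMap.trace_eq_matrix_trace ℝ h.basis, Matrix.trace]
  simp [LinearMap.toMatrix_apply, h.basis_repr, h.basis_apply]

theorem endNormSq_eq (h : g.IsDualPair x u u')
    (A : TangentSpace 𝓘(ℝ, E) x →L[ℝ] TangentSpace 𝓘(ℝ, E) x) :
    g.endNormSq x A = ∑ i, g.val x (A (u i)) (A (u' i)) := by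
  rw [endNormSq, metricTrace, h.trace_eq]
  exact Finset.sum_congr rfl fun i _ ↦ g.val_sharp x _ _

end IsDualPair

/-- If the vectors `u i` form a basis, the Gram matrix of `g` is invertible. -/
theorem det_gram_ne_zero {ι : Type*} [Fintype ι] [DecidableEq ι]
    (b : Module.Basis ι ℝ (TangentSpace 𝓘(ℝ, E) x)) :
    (Matrix.of fun i j ↦ g.val x (b i) (b j)).det ≠ 0 := by
  intro h
  obtain ⟨v, hv, hv0⟩ := Matrix.exists_vecMul_eq_zero_iff.2 h
  apply hv
  have : ∑ i, v i • b i = 0 := by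
    refine g.nondegenerate x _ fun w ↦ ?_
    rw [← b.sum_repr w]
    have h2 (j) : ∑ i, v i * g.val x (b i) (b j) = 0 := by
      simpa [Matrix.vecMul, dotProduct] using congrFun hv0 j
    simp only [map_sum, map_smul, sum_apply, smul_apply,
      smul_eq_mul, h2, mul_zero, Finset.sum_const_zero]
  exact funext fun i ↦ Fintype.linearIndependent_iff.1 b.linearIndependent v this i

theorem contMDiffAt_det {ι : Type*} [Fintype ι] [DecidableEq ι] {A : M → Matrix ι ι ℝ}
    (hA : ∀ i j, CMDiffAt ∞ (fun y ↦ A y i j) x) : CMDiffAt ∞ (fun y ↦ (A y).det) x := by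
  simp only [Matrix.det_apply']
  exact contMDiffAt_finsetSum fun σ _ ↦
    contMDiffAt_const.mul (contMDiffAt_finsetProd fun i _ ↦ hA _ _)

theorem contMDiffAt_inv {ι : Type*} [Fintype ι] [DecidableEq ι] {A : M → Matrix ι ι ℝ}
    (hA : ∀ i j, CMDiffAt ∞ (fun y ↦ A y i j) x) (hdet : (A x).det ≠ 0) (i j : ι) :
    CMDiffAt ∞ (fun y ↦ (A y)⁻¹ i j) x := by
  simp only [Matrix.inv_def, Matrix.smul_apply, Ring.inverse_eq_inv', Matrix.adjugate_apply,
    smul_eq_mul]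
  refine ((contMDiffAt_det hA).inv₀ hdet).mul (contMDiffAt_det fun k l ↦ ?_)
  by_cases hk : k = j
  · simpa [Matrix.updateRow_apply, hk] using contMDiffAt_const
  · simpa [Matrix.updateRow_apply, hk] using hA k l

/-- A pair of frames near `x`, smooth near `x`, that are dual to each other with respect to `g`. -/
structure IsDualFrame {ι : Type*} [Fintype ι] [DecidableEq ι] (x : M)
    (c c' : ι → Π x : M, TangentSpace 𝓘(ℝ, E) x) : Prop where
  smooth : ∀ᶠ y in 𝓝 x, ∀ i, CMDiffAt ∞ (T% (c i)) y
  smooth' : ∀ᶠ y in 𝓝 x, ∀ i, CMDiffAt ∞ (T% (c' i)) y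
  dual : ∀ᶠ y in 𝓝 x, g.IsDualPair y (c · y) (c' · y)

theorem eventually_contMDiffAt_extend (v : TangentSpace 𝓘(ℝ, E) x) :
    ∀ᶠ y in 𝓝 x, CMDiffAt ∞ (T% (extend E v : Π y : M, TangentSpace 𝓘(ℝ, E) y)) y := by
  obtain ⟨s, hs, h⟩ := exists_contMDiffOn_extend (k := ∞) 𝓘(ℝ, E) E v
  filter_upwards [eventually_mem_nhds_iff.2 hs] with y hy
  exact h.contMDiffAt hy

/-- A smooth frame near `x` has a smooth dual frame, with coefficients the inverse of its Gram
matrix. -/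
theorem exists_isDualFrame {ι : Type*} [Fintype ι] [DecidableEq ι]
    {c : ι → Π x : M, TangentSpace 𝓘(ℝ, E) x}
    (hc : ∀ i, ∀ᶠ y in 𝓝 x, CMDiffAt ∞ (T% (c i)) y)
    (b : Module.Basis ι ℝ (TangentSpace 𝓘(ℝ, E) x)) (hb : ∀ i, b i = c i x) :
    ∃ c', g.IsDualFrame x c c' := by
  let G (y : M) : Matrix ι ι ℝ := .of fun i j ↦ g.val y (c i y) (c j y)
  have hc' : ∀ᶠ y in 𝓝 x, ∀ i, CMDiffAt ∞ (T% (c i)) y := eventually_all.2 hc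
  have hG : ∀ᶠ y in 𝓝 x, ∀ i j, CMDiffAt ∞ (fun z ↦ G z i j) y := by
    filter_upwards [hc'] with y hy i j
    exact g.contMDiffAt_val (hy i) (hy j)
  have hdet : ∀ᶠ y in 𝓝 x, (G y).det ≠ 0 := by
    refine (contMDiffAt_det hG.self_of_nhds).continuousAt.eventually_ne ?_
    simpa [G, hb] using g.det_gram_ne_zero b
  refine ⟨fun j y ↦ ∑ k, (G y)⁻¹ k j • c k y, hc', ?_, ?_⟩
  · filter_upwards [hc', hG, hdet] with y h1 h2 h3 j
    exact .sum_section fun k _ ↦ (contMDiffAt_inv h2 h3 k j).smul_section (h1 k)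
  · filter_upwards [hdet] with y h3
    refine ⟨(Module.finrank_eq_card_basis b).symm, fun i j ↦ ?_⟩
    have := congrFun (congrFun (Matrix.mul_nonsing_inv (G y) (isUnit_iff_ne_zero.2 h3)) i) j
    simp only [Matrix.mul_apply, Matrix.one_apply] at this
    rw [← this]
    simp [G, mul_comm]

/-- Around each point there is a pair of dual smooth frames. -/
theorem exists_dualFrame (x : M) :
    ∃ c c' : Fin (Module.finrank ℝ E) → Π x : M, TangentSpace 𝓘(ℝ, E) x, g.IsDualFrame x c c' :=
  ⟨_, g.exists_isDualFrame (fun _ ↦ eventually_contMDiffAt_extend _)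
    (Module.finBasis ℝ (TangentSpace 𝓘(ℝ, E) x)) fun _ ↦ (extend_apply_self E _).symm⟩

/-! ### Smoothness of gradients and covariant derivatives -/

/-- A vector field is smooth if its inner products with smooth vector fields are. -/
theorem contMDiffAt_of_val
    (h : ∀ W : Π x : M, TangentSpace 𝓘(ℝ, E) x, CMDiffAt ∞ (T% W) x →
      CMDiffAt ∞ (fun y ↦ g.val y (V y) (W y)) x) : CMDiffAt ∞ (T% V) x := by
  obtain ⟨c, c', hc⟩ := g.exists_dualFrame x
  have h1 : CMDiffAt ∞ (T% (fun y ↦ ∑ i, g.val y (V y) (c' i y) • c i y)) x :=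
    .sum_section fun i _ ↦
      (h _ (hc.smooth'.self_of_nhds i)).smul_section (hc.smooth.self_of_nhds i)
  refine h1.congr_of_eventuallyEq ?_
  filter_upwards [hc.dual] with y hy
  simp [hy.sum_repr]

theorem val_gradient (f : M → ℝ) (v : TangentSpace 𝓘(ℝ, E) x) :
    g.val x (g.gradient f x) v = mvfderiv 𝓘(ℝ, E) f x v :=
  g.val_sharp x _ v

theorem contMDiffAt_gradient (hf : CMDiffAt ∞ f x) : CMDiffAt ∞ (T% (g.gradient f)) x :=
  g.contMDiffAt_of_val fun W hW ↦ by simpa [val_gradient] using hf.mvfderiv_apply hW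

/-- The covariant derivative `∇_X Y` as a vector field. -/
def nabla (X Y : Π x : M, TangentSpace 𝓘(ℝ, E) x) (x : M) : TangentSpace 𝓘(ℝ, E) x :=
  g.leviCivita Y x (X x)

/-- `∇_X Y` is smooth, since the Koszul formula expresses its inner products with smooth fields
through derivatives and brackets of smooth objects. -/
theorem contMDiffAt_nabla (hX : CMDiffAt ∞ (T% X) x) (hY : CMDiffAt ∞ (T% Y) x) :
    CMDiffAt ∞ (T% (g.nabla X Y)) x := by
  refine g.contMDiffAt_of_val fun W hW ↦ ?_
  have h : CMDiffAt ∞ (fun y ↦ (1 / 2 : ℝ) * g.koszul X Y W y) x := by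
    refine contMDiffAt_const.mul ?_
    unfold koszul
    refine .sub (.sub (.add (.sub (.add ?_ ?_) ?_) ?_) ?_) ?_
    · exact (g.contMDiffAt_val hY hW).mvfderiv_apply hX
    · exact (g.contMDiffAt_val hX hW).mvfderiv_apply hY
    · exact (g.contMDiffAt_val hX hY).mvfderiv_apply hW
    · exact g.contMDiffAt_val (hX.mlieBracket_of_smooth hY) hW
    · exact g.contMDiffAt_val (hX.mlieBracket_of_smooth hW) hY
    · exact g.contMDiffAt_val (hY.mlieBracket_of_smooth hW) hX
  refine h.congr_of_eventuallyEq ?_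
  filter_upwards [hX.eventually_mdifferentiableAt, hY.eventually_mdifferentiableAt,
    hW.eventually_mdifferentiableAt] with y h1 h2 h3
  exact g.val_leviCivita h1 h2 h3

/-! ### Symmetries of the curvature -/

theorem leviCivita_congr (hX : MDiffAt (T% X) x) (hY : MDiffAt (T% Y) x)
    (h : ∀ᶠ y in 𝓝 x, X y = Y y) : g.leviCivita X x = g.leviCivita Y x :=
  g.leviCivita.isCovariantDerivativeOnUniv.congr_of_eventuallyEq hX hY univ_mem h

theorem nabla_sub_nabla (hX : MDiffAt (T% X) x) (hY : MDiffAt (T% Y) x) :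
    g.nabla X Y x - g.nabla Y X x = mlieBracket 𝓘(ℝ, E) X Y x :=
  (CovariantDerivative.torsion_eq_zero_iff _).1 g.leviCivita_torsion hX hY

theorem mvfderiv_val (hX : MDiffAt (T% X) x) (hY : MDiffAt (T% Y) x) (hZ : MDiffAt (T% Z) x) :
    mvfderiv 𝓘(ℝ, E) (fun y ↦ g.val y (Y y) (Z y)) x (X x) =
      g.val x (g.nabla X Y x) (Z x) + g.val x (Y x) (g.nabla X Z x) :=
  g.leviCivita_metric hX hY hZ

theorem curvature_eq : g.curvature X Y Z x = g.nabla X (g.nabla Y Z) x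
    - g.nabla Y (g.nabla X Z) x - g.nabla (mlieBracket 𝓘(ℝ, E) X Y) Z x := rfl

theorem contMDiffAt_curvature (hX : CMDiffAt ∞ (T% X) x) (hY : CMDiffAt ∞ (T% Y) x)
    (hZ : CMDiffAt ∞ (T% Z) x) : CMDiffAt ∞ (T% (g.curvature X Y Z)) x :=
  ((g.contMDiffAt_nabla hX (g.contMDiffAt_nabla hY hZ)).sub_section
    (g.contMDiffAt_nabla hY (g.contMDiffAt_nabla hX hZ))).sub_section
    (g.contMDiffAt_nabla (hX.mlieBracket_of_smooth hY) hZ)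

theorem curvature_swap : g.curvature X Y Z x = - g.curvature Y X Z x := by
  have : mlieBracket 𝓘(ℝ, E) Y X x = - mlieBracket 𝓘(ℝ, E) X Y x := mlieBracket_swap_apply
  simp only [curvature, this, map_neg]
  abel

/-- The Hessian of a function is symmetric. -/
theorem val_nabla_gradient_comm (hf : CMDiffAt ∞ f x) (hX : CMDiffAt ∞ (T% X) x)
    (hY : CMDiffAt ∞ (T% Y) x) :
    g.val x (g.nabla X (g.gradient f) x) (Y x) = g.val x (g.nabla Y (g.gradient f) x) (X x) := by
  have hX' := hX.mdifferentiableAt_of_smooth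
  have hY' := hY.mdifferentiableAt_of_smooth
  have hξ := (g.contMDiffAt_gradient hf).mdifferentiableAt_of_smooth
  have h1 := g.mvfderiv_val hX' hξ hY'
  have h2 := g.mvfderiv_val hY' hξ hX'
  have h3 := mvfderiv_mlieBracket hf hX hY
  rw [← g.nabla_sub_nabla hX' hY', map_sub] at h3
  simp only [val_gradient] at h1 h2
  linarith

/-- The curvature endomorphism `R(X, Y)` is skew with respect to the metric. -/
theorem val_curvature_skew (hX : CMDiffAt ∞ (T% X) x) (hY : CMDiffAt ∞ (T% Y) x)
    (hZ : CMDiffAt ∞ (T% Z) x) (hV : CMDiffAt ∞ (T% V) x) :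
    g.val x (g.curvature X Y Z x) (V x) = - g.val x (g.curvature X Y V x) (Z x) := by
  -- `A (B g(Z, V))` for two fields `A` and `B`
  have key {A B : Π x : M, TangentSpace 𝓘(ℝ, E) x} (hA : CMDiffAt ∞ (T% A) x)
      (hB : CMDiffAt ∞ (T% B) x) :
      mvfderiv 𝓘(ℝ, E) (fun y ↦ mvfderiv 𝓘(ℝ, E) (fun z ↦ g.val z (Z z) (V z)) y (B y)) x (A x) =
        g.val x (g.nabla A (g.nabla B Z) x) (V x) + g.val x (g.nabla B Z x) (g.nabla A V x)
        + (g.val x (g.nabla A Z x) (g.nabla B V x) + g.val x (Z x) (g.nabla A (g.nabla B V) x)) := by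
    have hA' := hA.mdifferentiableAt_of_smooth
    have hBZ := (g.contMDiffAt_nabla hB hZ).mdifferentiableAt_of_smooth
    have hBV := (g.contMDiffAt_nabla hB hV).mdifferentiableAt_of_smooth
    have hZ' := hZ.mdifferentiableAt_of_smooth
    have hV' := hV.mdifferentiableAt_of_smooth
    rw [← g.mvfderiv_val hA' hBZ hV', ← g.mvfderiv_val hA' hZ' hBV,
      mvfderiv_congr_of_eventuallyEq (f₂ := fun y ↦ g.val y (g.nabla B Z y) (V y) +
        g.val y (Z y) (g.nabla B V y)),
      mvfderiv_fun_add (g.mdifferentiableAt_val hBZ hV') (g.mdifferentiableAt_val hZ' hBV)]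
    · rfl
    · filter_upwards [hB.eventually_mdifferentiableAt, hZ.eventually_mdifferentiableAt,
        hV.eventually_mdifferentiableAt] with y h1 h2 h3
      exact g.mvfderiv_val h1 h2 h3
  have h1 := mvfderiv_mlieBracket (g.contMDiffAt_val hZ hV) hX hY
  rw [key hX hY, key hY hX, g.mvfderiv_val
    (hX.mlieBracket_of_smooth hY).mdifferentiableAt_of_smooth hZ.mdifferentiableAt_of_smooth
    hV.mdifferentiableAt_of_smooth] at h1
  rw [g.symm x _ (Z x)]
  simp only [curvature_eq, map_sub, sub_apply]
  linarith

/-- The first Bianchi identity. -/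
theorem curvature_cyclic (hX : CMDiffAt ∞ (T% X) x) (hY : CMDiffAt ∞ (T% Y) x)
    (hZ : CMDiffAt ∞ (T% Z) x) :
    g.curvature X Y Z x + g.curvature Y Z X x + g.curvature Z X Y x = 0 := by
  have : IsManifold 𝓘(ℝ, E) (minSmoothness ℝ 3) M :=
    .of_le (n := ∞) (by simp; norm_cast)
  -- `∇_A ∇_B C = ∇_A ∇_C B + ∇_A [B, C]`
  have key {A B C : Π x : M, TangentSpace 𝓘(ℝ, E) x} (hA : CMDiffAt ∞ (T% A) x)
      (hB : CMDiffAt ∞ (T% B) x) (hC : CMDiffAt ∞ (T% C) x) :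
      g.nabla A (g.nabla B C) x =
        g.nabla A (g.nabla C B) x + g.nabla A (mlieBracket 𝓘(ℝ, E) B C) x := by
    have h1 := (g.contMDiffAt_nabla hC hB).mdifferentiableAt_of_smooth
    have h2 := (hB.mlieBracket_of_smooth hC).mdifferentiableAt_of_smooth
    have h3 := g.leviCivita.isCovariantDerivativeOnUniv.add h1 h2
    rw [nabla, g.leviCivita_congr (g.contMDiffAt_nabla hB hC).mdifferentiableAt_of_smooth
      (mdifferentiableAt_add_section h1 h2), h3]
    · rfl
    · filter_upwards [hB.eventually_mdifferentiableAt, hC.eventually_mdifferentiableAt] with y h4 h5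
      simp [← g.nabla_sub_nabla h4 h5]
  have h1 := key hX hY hZ
  have h2 := key hY hX hZ
  have h3 := key hZ hX hY
  have hs : mlieBracket 𝓘(ℝ, E) Z X x = - mlieBracket 𝓘(ℝ, E) X Z x := mlieBracket_swap_apply
  have hs' : g.nabla (mlieBracket 𝓘(ℝ, E) Z X) Y x = - g.nabla (mlieBracket 𝓘(ℝ, E) X Z) Y x := by
    simp [nabla, hs]
  have t1 := g.nabla_sub_nabla hX.mdifferentiableAt_of_smooth
    (hY.mlieBracket_of_smooth hZ).mdifferentiableAt_of_smooth
  have t2 := g.nabla_sub_nabla hY.mdifferentiableAt_of_smooth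
    (hX.mlieBracket_of_smooth hZ).mdifferentiableAt_of_smooth
  have t3 := g.nabla_sub_nabla (hX.mlieBracket_of_smooth hY).mdifferentiableAt_of_smooth
    hZ.mdifferentiableAt_of_smooth
  have hle : minSmoothness ℝ 2 ≤ ∞ := by simp; norm_cast
  have hj := leibniz_identity_mlieBracket_apply (hX.of_le hle) (hY.of_le hle) (hZ.of_le hle)
  rw [← t1, ← t2, ← t3] at hj
  simp only [curvature_eq, h1, h2, h3, hs']
  rw [← sub_eq_zero] at hj
  rw [← hj]
  abel

/-- The pair symmetry of the curvature tensor. Its right-hand side depends on the field `Y` only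
through the value of `Y` at `x`, so that it also shows that the curvature is a tensor. -/
theorem val_curvature_pair_symm (hX : CMDiffAt ∞ (T% X) x) (hY : CMDiffAt ∞ (T% Y) x)
    (hZ : CMDiffAt ∞ (T% Z) x) (hV : CMDiffAt ∞ (T% V) x) :
    g.val x (g.curvature X Y Z x) (V x) = g.val x (g.curvature Z V X x) (Y x) := by
  have sw (A B C D : Π x : M, TangentSpace 𝓘(ℝ, E) x) :
      g.val x (g.curvature A B C x) (D x) = - g.val x (g.curvature B A C x) (D x) := by
    rw [curvature_swap]; simp
  have cyc {A B C : Π x : M, TangentSpace 𝓘(ℝ, E) x} (D : Π x : M, TangentSpace 𝓘(ℝ, E) x)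
      (hA : CMDiffAt ∞ (T% A) x) (hB : CMDiffAt ∞ (T% B) x) (hC : CMDiffAt ∞ (T% C) x) :
      g.val x (g.curvature A B C x) (D x) + g.val x (g.curvature B C A x) (D x)
        + g.val x (g.curvature C A B x) (D x) = 0 := by
    simpa using congrArg (fun w ↦ g.val x w (D x)) (g.curvature_cyclic hA hB hC)
  have b1 := cyc V hX hY hZ
  have b2 := cyc X hY hZ hV
  have b3 := cyc Y hZ hV hX
  have b4 := cyc Z hV hX hY
  have s1 := g.val_curvature_skew hX hY hZ hV
  have s2 := g.val_curvature_skew hY hZ hX hV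
  have s3 := g.val_curvature_skew hZ hX hY hV
  have s4 := g.val_curvature_skew hX hV hY hZ
  have s5 := g.val_curvature_skew hY hV hX hZ
  have s6 := g.val_curvature_skew hZ hV hX hY
  have w1 := sw V X Y Z
  have w2 := sw V X Z Y
  have w3 := sw V Y X Z
  have w4 := sw V Y Z X
  have w5 := sw Z X V Y
  linarith

/-! ### The curvature and the Ricci tensor in a frame -/

theorem contMDiffAt_extend_smooth (v : TangentSpace 𝓘(ℝ, E) x) :
    CMDiffAt ∞ (T% (extend E v : Π y : M, TangentSpace 𝓘(ℝ, E) y)) x :=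
  contMDiffAt_extend 𝓘(ℝ, E) E v

/-- The curvature depends on its first argument only through its value at the point. -/
theorem curvature_congr_left {X' : Π x : M, TangentSpace 𝓘(ℝ, E) x} (hX : CMDiffAt ∞ (T% X) x)
    (hX' : CMDiffAt ∞ (T% X') x) (hY : CMDiffAt ∞ (T% Y) x) (hZ : CMDiffAt ∞ (T% Z) x)
    (h : X x = X' x) : g.curvature X Y Z x = g.curvature X' Y Z x := by
  refine g.ext_val fun u ↦ ?_
  have hu := contMDiffAt_extend_smooth u
  have h1 := g.val_curvature_pair_symm hX hY hZ hu
  have h2 := g.val_curvature_pair_symm hX' hY hZ hu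
  rw [g.val_curvature_skew hZ hu hX hY] at h1
  rw [g.val_curvature_skew hZ hu hX' hY, ← h, ← h1] at h2
  simpa using h2.symm

theorem curvature_congr_middle {Y' : Π x : M, TangentSpace 𝓘(ℝ, E) x} (hX : CMDiffAt ∞ (T% X) x)
    (hY : CMDiffAt ∞ (T% Y) x) (hY' : CMDiffAt ∞ (T% Y') x) (hZ : CMDiffAt ∞ (T% Z) x)
    (h : Y x = Y' x) : g.curvature X Y Z x = g.curvature X Y' Z x := by
  rw [curvature_swap, g.curvature_congr_left hY hY' hX hZ h, ← curvature_swap]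

theorem curvature_congr_right {Z' : Π x : M, TangentSpace 𝓘(ℝ, E) x} (hX : CMDiffAt ∞ (T% X) x)
    (hY : CMDiffAt ∞ (T% Y) x) (hZ : CMDiffAt ∞ (T% Z) x) (hZ' : CMDiffAt ∞ (T% Z') x)
    (h : Z x = Z' x) : g.curvature X Y Z x = g.curvature X Y Z' x := by
  refine g.ext_val fun u ↦ ?_
  have hu := contMDiffAt_extend_smooth u
  have h1 := g.val_curvature_skew hX hY hZ hu
  have h2 := g.val_curvature_skew hX hY hZ' hu
  rw [← h, ← h1] at h2
  simpa using h2.symm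

theorem curvature_eq_zero_of_right (hX : CMDiffAt ∞ (T% X) x) (hY : CMDiffAt ∞ (T% Y) x)
    (hZ : CMDiffAt ∞ (T% Z) x) (h : Z x = 0) : g.curvature X Y Z x = 0 := by
  refine g.ext_val fun u ↦ ?_
  have h1 := g.val_curvature_skew hX hY hZ (contMDiffAt_extend_smooth u)
  simpa [h] using h1

theorem curvature_eq_zero_of_middle (hX : CMDiffAt ∞ (T% X) x) (hY : CMDiffAt ∞ (T% Y) x)
    (hZ : CMDiffAt ∞ (T% Z) x) (h : Y x = 0) : g.curvature X Y Z x = 0 := by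
  refine g.ext_val fun u ↦ ?_
  have h1 := g.val_curvature_pair_symm hX hY hZ (contMDiffAt_extend_smooth u)
  simpa [h] using h1

/-- The curvature as a linear function of the value of its first argument, expanded in a pair of
dual frames. -/
theorem curvature_eq_sum {ι : Type*} [Fintype ι] [DecidableEq ι]
    {c c' : ι → Π x : M, TangentSpace 𝓘(ℝ, E) x} (hc : ∀ i, CMDiffAt ∞ (T% (c i)) x)
    (h : g.IsDualPair x (c · x) (c' · x)) (hX : CMDiffAt ∞ (T% X) x) (hY : CMDiffAt ∞ (T% Y) x)
    (hZ : CMDiffAt ∞ (T% Z) x) :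
    g.curvature X Y Z x = ∑ i, g.val x (X x) (c' i x) • g.curvature (c i) Y Z x := by
  refine g.ext_val fun u ↦ ?_
  have hu := contMDiffAt_extend_smooth u
  -- By pair symmetry the curvature is linear in the value of its first argument.
  have key {A : Π x : M, TangentSpace 𝓘(ℝ, E) x} (hA : CMDiffAt ∞ (T% A) x) :
      g.val x (g.curvature A Y Z x) u = - g.val x (A x) (g.curvature Z (extend E u) Y x) := by
    have h1 := g.val_curvature_pair_symm hA hY hZ hu
    rw [g.val_curvature_skew hZ hu hA hY] at h1
    simpa [g.symm x _ (A x)] using h1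
  rw [key hX, h.val_eq_sum]
  simp [key (hc _)]

/-- The Ricci tensor as the trace of the curvature over a pair of dual frames. -/
theorem ricci_eq_sum {ι : Type*} [Fintype ι] [DecidableEq ι]
    {c c' : ι → Π x : M, TangentSpace 𝓘(ℝ, E) x} (hc : ∀ i, CMDiffAt ∞ (T% (c i)) x)
    (h : g.IsDualPair x (c · x) (c' · x)) (hY : CMDiffAt ∞ (T% Y) x) (hZ : CMDiffAt ∞ (T% Z) x) :
    g.ricci x (Y x) (Z x) = ∑ i, g.val x (g.curvature (c i) Y Z x) (c' i x) := by
  set b := Module.finBasis ℝ (TangentSpace 𝓘(ℝ, E) x)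
  have h1 (i) : g.curvature (extend E (b i)) (extend E (Y x)) (extend E (Z x)) x =
      ∑ j, g.val x (b i) (c' j x) • g.curvature (c j) Y Z x := by
    have hb := contMDiffAt_extend_smooth (b i)
    have hY' := contMDiffAt_extend_smooth (Y x)
    rw [g.curvature_congr_right hb hY' (contMDiffAt_extend_smooth (Z x)) hZ (by simp),
      g.curvature_congr_middle hb hY' hY hZ (by simp), g.curvature_eq_sum hc h hb hY hZ]
    simp
  have h2 : g.ricci x (Y x) (Z x) = ∑ i, b.coord i
    (g.curvature (extend E (b i)) (extend E (Y x)) (extend E (Z x)) x) := rfl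
  simp only [h2, h1, map_sum, map_smul, smul_eq_mul, Module.Basis.coord_apply]
  rw [Finset.sum_comm]
  refine Finset.sum_congr rfl fun j _ ↦ ?_
  have h3 := congrArg (fun w ↦ g.val x w (c' j x)) (b.sum_repr (g.curvature (c j) Y Z x))
  simp only [map_sum, map_smul, sum_apply, smul_apply, smul_eq_mul] at h3
  rw [← h3]
  exact Finset.sum_congr rfl fun i _ ↦ mul_comm ..

/-! ### Synchronous frames -/

theorem leviCivita_sum {ι : Type*} (s : Finset ι) {V : ι → Π x : M, TangentSpace 𝓘(ℝ, E) x}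
    (hV : ∀ i ∈ s, MDiffAt (T% (V i)) x) :
    g.leviCivita (fun y ↦ ∑ i ∈ s, V i y) x = ∑ i ∈ s, g.leviCivita (V i) x := by
  classical
  induction s using Finset.induction_on with
  | empty => simpa only [Finset.sum_empty] using! congrFun g.leviCivita.zero x
  | insert a s ha ih =>
    simp only [Finset.sum_insert ha]
    rw [← ih fun i hi ↦ hV i (Finset.mem_insert_of_mem hi)]
    exact g.leviCivita.isCovariantDerivativeOnUniv.add (hV a (Finset.mem_insert_self a s))
      (.sum_section fun i hi ↦ hV i (Finset.mem_insert_of_mem hi))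

theorem nabla_sub (hY : MDiffAt (T% Y) x) (hZ : MDiffAt (T% Z) x) :
    g.nabla X (fun y ↦ Y y - Z y) x = g.nabla X Y x - g.nabla X Z x := by
  have h1 := g.leviCivita.isCovariantDerivativeOnUniv.smul_const (-1 : ℝ) hZ
  have h2 := g.leviCivita.isCovariantDerivativeOnUniv.add hY
    (mdifferentiableAt_const (c := (-1 : ℝ)).smul_section hZ)
  have h3 : (fun y ↦ Y y - Z y) = Y + (-1 : ℝ) • Z := by
    ext y; simp [sub_eq_add_neg]
  simp only [nabla, h3]
  refine (DFunLike.congr_fun h2 (X x)).trans ?_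
  change g.leviCivita Y x (X x) + g.leviCivita ((-1 : ℝ) • Z) x (X x) = _
  rw [h1]
  simp [sub_eq_add_neg]

theorem mdifferentiableAt_sum {ι : Type} {s : Finset ι} {a : ι → M → ℝ}
    (ha : ∀ i ∈ s, MDiffAt (a i) x) : MDiffAt (fun y ↦ ∑ i ∈ s, a i y) x := by
  have := MDifferentiableAt.sum (E' := ℝ) (t := s) (f := a) ha
  simpa only [Finset.sum_fn] using this

theorem mvfderiv_sum {ι : Type} (s : Finset ι) {a : ι → M → ℝ} (ha : ∀ i ∈ s, MDiffAt (a i) x) :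
    mvfderiv 𝓘(ℝ, E) (fun y ↦ ∑ i ∈ s, a i y) x = ∑ i ∈ s, mvfderiv 𝓘(ℝ, E) (a i) x := by
  classical
  induction s using Finset.induction_on with
  | empty => simpa using mvfderiv_const (0 : ℝ)
  | insert i s hi ih =>
    have h1 := fun j hj ↦ ha j (Finset.mem_insert_of_mem hj)
    simp only [Finset.sum_insert hi]
    rw [← ih h1]
    exact mvfderiv_fun_add (ha i (Finset.mem_insert_self i s)) (mdifferentiableAt_sum h1)

/-- Each covector at `x` is the differential of a function that is smooth near `x` and vanishes
at `x`. -/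
theorem exists_mvfderiv_eq (ℓ : TangentSpace 𝓘(ℝ, E) x →L[ℝ] ℝ) :
    ∃ a : M → ℝ, (∀ᶠ y in 𝓝 x, CMDiffAt ∞ a y) ∧ a x = 0 ∧ mvfderiv 𝓘(ℝ, E) a x = ℓ := by
  let φ := extChartAt 𝓘(ℝ, E) x
  let L : E →L[ℝ] ℝ := ℓ
  have hL : ContMDiff 𝓘(ℝ, E) 𝓘(ℝ) ∞ fun u ↦ L (u - φ x) :=
    (L.contDiff.comp (contDiff_id.sub contDiff_const)).contMDiff
  refine ⟨fun y ↦ L (φ y - φ x), ?_, by simp, ?_⟩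
  · filter_upwards [chart_source_mem_nhds E x] with y hy
    exact hL.contMDiffAt.comp y (contMDiffAt_extChartAt' hy)
  · have h1 := mvfderiv_comp (g := fun u ↦ L (u - φ x)) (f := φ) x
      (hL.contMDiffAt.mdifferentiableAt (by simp))
      (mdifferentiableAt_extChartAt (mem_chart_source E x))
    refine h1.trans ?_
    rw [mfderiv_extChartAt_self]
    have h2 : HasFDerivAt (fun u ↦ L (u - φ x)) L (φ x) :=
      L.hasFDerivAt.comp (φ x) ((hasFDerivAt_id (φ x)).sub_const (φ x))
    exact mfderiv_eq_fderiv.trans h2.fderiv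

/-- Each tangent vector at `x` extends to a vector field smooth near `x` whose covariant
derivative vanishes at `x`. -/
theorem exists_extension_leviCivita_eq_zero (v : TangentSpace 𝓘(ℝ, E) x) :
    ∃ V : Π x : M, TangentSpace 𝓘(ℝ, E) x, (∀ᶠ y in 𝓝 x, CMDiffAt ∞ (T% V) y) ∧ V x = v ∧
      g.leviCivita V x = 0 := by
  let b := Module.finBasis ℝ (TangentSpace 𝓘(ℝ, E) x)
  let A := g.leviCivita (extend E v) x
  choose a ha ha0 hda using fun i ↦ exists_mvfderiv_eq (x := x)
    (- LinearMap.toContinuousLinearMap (b.coord i ∘ₗ A.toLinearMap))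
  have hs := fun i ↦ ((ha i).self_of_nhds.mdifferentiableAt (by simp)).smul_section
    (contMDiffAt_extend_smooth (b i)).mdifferentiableAt_of_smooth
  refine ⟨fun y ↦ extend E v y + ∑ i, a i y • extend E (b i) y, ?_, by simp [ha0], ?_⟩
  · filter_upwards [eventually_contMDiffAt_extend v, eventually_all.2 ha,
      eventually_all.2 fun i ↦ eventually_contMDiffAt_extend (b i)] with y h1 h2 h3
    exact h1.add_section (.sum_section fun i _ ↦ (h2 i).smul_section (h3 i))
  · refine (g.leviCivita.isCovariantDerivativeOnUniv.add
      (contMDiffAt_extend_smooth v).mdifferentiableAt_of_smooth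
      (.sum_section fun i _ ↦ hs i)).trans ?_
    rw [g.leviCivita_sum _ fun i _ ↦ hs i]
    have h1 (i) : g.leviCivita (fun y ↦ a i y • extend E (b i) y) x =
        (mvfderiv 𝓘(ℝ, E) (a i) x).smulRight (b i) := by
      have := g.leviCivita.isCovariantDerivativeOnUniv.leibniz
        (contMDiffAt_extend_smooth (b i)).mdifferentiableAt_of_smooth
        ((ha i).self_of_nhds.mdifferentiableAt (by simp))
      refine this.trans ?_
      simp [ha0]
    refine (congrArg (A + ·) (Finset.sum_congr rfl fun i _ ↦ h1 i)).trans ?_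
    ext u
    have h2 := b.sum_repr (A u)
    simp [hda, h2]

/-- A pair of dual frames near `x` whose covariant derivatives vanish at `x`. -/
structure IsSynchronousFrame {ι : Type*} [Fintype ι] [DecidableEq ι] (x : M)
    (c c' : ι → Π x : M, TangentSpace 𝓘(ℝ, E) x) : Prop extends g.IsDualFrame x c c' where
  leviCivita_eq_zero (i : ι) : g.leviCivita (c i) x = 0
  leviCivita_eq_zero' (i : ι) : g.leviCivita (c' i) x = 0

/-- Synchronous frames exist: the dual of a frame whose covariant derivatives vanish at `x` has the
same property, because `g(c i, c' j)` is constant near `x`. -/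
theorem exists_isSynchronousFrame (x : M) :
    ∃ c c' : Fin (Module.finrank ℝ E) → Π x : M, TangentSpace 𝓘(ℝ, E) x,
      g.IsSynchronousFrame x c c' := by
  let b : Module.Basis (Fin (Module.finrank ℝ E)) ℝ (TangentSpace 𝓘(ℝ, E) x) :=
    Module.finBasis ℝ (TangentSpace 𝓘(ℝ, E) x)
  choose c hc hcb hc0 using fun i ↦ g.exists_extension_leviCivita_eq_zero (b i)
  obtain ⟨c', h⟩ := g.exists_isDualFrame hc b fun i ↦ (hcb i).symm
  refine ⟨c, c', h, hc0, fun j ↦ ?_⟩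
  ext u
  have hd := h.dual.self_of_nhds
  rw [← hd.symm.sum_repr (g.leviCivita (c' j) x u)]
  refine Finset.sum_eq_zero fun i _ ↦ ?_
  have h1 := g.mvfderiv_val (contMDiffAt_extend_smooth u).mdifferentiableAt_of_smooth
    (h.smooth.self_of_nhds i).mdifferentiableAt_of_smooth
    (h.smooth'.self_of_nhds j).mdifferentiableAt_of_smooth
  rw [mvfderiv_congr_of_eventuallyEq (f₂ := fun _ ↦ if i = j then 1 else 0)
    (h.dual.mono fun y hy ↦ hy.val_eq i j), mvfderiv_const] at h1
  simp [nabla, hc0] at h1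
  simp [g.symm x _ (c i x), ← h1]

/-! ### The second Bianchi identity -/

theorem mlieBracket_eq_zero (hX : CMDiffAt ∞ (T% X) x) (hY : CMDiffAt ∞ (T% Y) x)
    (hX0 : g.leviCivita X x = 0) (hY0 : g.leviCivita Y x = 0) :
    mlieBracket 𝓘(ℝ, E) X Y x = 0 := by
  rw [← g.nabla_sub_nabla hX.mdifferentiableAt_of_smooth hY.mdifferentiableAt_of_smooth]
  simp [nabla, hX0, hY0]

/-- The second Bianchi identity, for fields whose covariant derivatives vanish at `x`. -/
theorem nabla_curvature_cyclic (hX : CMDiffAt ∞ (T% X) x) (hY : CMDiffAt ∞ (T% Y) x)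
    (hW : CMDiffAt ∞ (T% W) x) (hZ : CMDiffAt ∞ (T% Z) x) (hX0 : g.leviCivita X x = 0)
    (hY0 : g.leviCivita Y x = 0) (hW0 : g.leviCivita W x = 0) (hZ0 : g.leviCivita Z x = 0) :
    g.nabla X (g.curvature Y W Z) x + g.nabla Y (g.curvature W X Z) x
      + g.nabla W (g.curvature X Y Z) x = 0 := by
  -- The second derivatives of `∇_C Z`, which vanishes at `x`, along fields with vanishing bracket
  -- at `x` commute there.
  have comm {A B C : Π x : M, TangentSpace 𝓘(ℝ, E) x} (hA : CMDiffAt ∞ (T% A) x)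
      (hB : CMDiffAt ∞ (T% B) x) (hC : CMDiffAt ∞ (T% C) x) (hA0 : g.leviCivita A x = 0)
      (hB0 : g.leviCivita B x = 0) :
      g.nabla A (g.nabla B (g.nabla C Z)) x = g.nabla B (g.nabla A (g.nabla C Z)) x := by
    have h := g.curvature_eq_zero_of_right hA hB (g.contMDiffAt_nabla hC hZ) (by simp [nabla, hZ0])
    have h2 : g.nabla (mlieBracket 𝓘(ℝ, E) A B) (g.nabla C Z) x = 0 := by
      rw [nabla, g.mlieBracket_eq_zero hA hB hA0 hB0, map_zero]
    rwa [curvature_eq, h2, sub_zero, sub_eq_zero] at h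
  have key {A B C : Π x : M, TangentSpace 𝓘(ℝ, E) x} (hA : CMDiffAt ∞ (T% A) x)
      (hB : CMDiffAt ∞ (T% B) x) (hC : CMDiffAt ∞ (T% C) x) (hB0 : g.leviCivita B x = 0)
      (hC0 : g.leviCivita C x = 0) :
      g.nabla A (g.curvature B C Z) x =
        g.nabla A (g.nabla B (g.nabla C Z)) x - g.nabla A (g.nabla C (g.nabla B Z)) x := by
    -- `∇_A ∇_[B,C] Z` vanishes at `x`: commuting the two derivatives leaves terms in `R(A, [B, C])Z`,
    -- `∇_[B,C]` and `∇Z`, each zero at `x`.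
    have hBC := hB.mlieBracket_of_smooth hC
    have hBC0 := g.mlieBracket_eq_zero hB hC hB0 hC0
    have h1 := g.curvature_eq_zero_of_middle hA hBC hZ hBC0
    have h2 : g.nabla (mlieBracket 𝓘(ℝ, E) B C) (g.nabla A Z) x = 0 := by
      rw [nabla, hBC0, map_zero]
    have h3 : g.nabla (mlieBracket 𝓘(ℝ, E) A (mlieBracket 𝓘(ℝ, E) B C)) Z x = 0 := by
      simp [nabla, hZ0]
    rw [curvature_eq, h2, h3, sub_zero, sub_zero] at h1
    have d1 := (g.contMDiffAt_nabla hB (g.contMDiffAt_nabla hC hZ))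
    have d2 := (g.contMDiffAt_nabla hC (g.contMDiffAt_nabla hB hZ))
    have d3 := (g.contMDiffAt_nabla hBC hZ)
    have e1 := g.nabla_sub (X := A) (d1.sub_section d2).mdifferentiableAt_of_smooth
      d3.mdifferentiableAt_of_smooth
    have e2 := g.nabla_sub (X := A) d1.mdifferentiableAt_of_smooth d2.mdifferentiableAt_of_smooth
    rw [h1, sub_zero] at e1
    exact e1.trans e2
  rw [key hX hY hW hY0 hW0, key hY hW hX hW0 hX0, key hW hX hY hX0 hY0, comm hX hY hW hX0 hY0,
    comm hX hW hY hX0 hW0, comm hY hW hX hY0 hW0]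
  abel

/-- The second Bianchi identity as a statement about derivatives of the functions
`g(R(·, ·)Z, V)`, for fields whose covariant derivatives vanish at `x`. -/
theorem mvfderiv_curvature_cyclic (hX : CMDiffAt ∞ (T% X) x) (hY : CMDiffAt ∞ (T% Y) x)
    (hW : CMDiffAt ∞ (T% W) x) (hZ : CMDiffAt ∞ (T% Z) x) (hV : CMDiffAt ∞ (T% V) x)
    (hX0 : g.leviCivita X x = 0) (hY0 : g.leviCivita Y x = 0) (hW0 : g.leviCivita W x = 0)
    (hZ0 : g.leviCivita Z x = 0) (hV0 : g.leviCivita V x = 0) :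
    mvfderiv 𝓘(ℝ, E) (fun y ↦ g.val y (g.curvature Y W Z y) (V y)) x (X x)
      + mvfderiv 𝓘(ℝ, E) (fun y ↦ g.val y (g.curvature W X Z y) (V y)) x (Y x)
      + mvfderiv 𝓘(ℝ, E) (fun y ↦ g.val y (g.curvature X Y Z y) (V y)) x (W x) = 0 := by
  have key {A B C : Π x : M, TangentSpace 𝓘(ℝ, E) x} (hA : CMDiffAt ∞ (T% A) x)
      (hB : CMDiffAt ∞ (T% B) x) (hC : CMDiffAt ∞ (T% C) x) :
      mvfderiv 𝓘(ℝ, E) (fun y ↦ g.val y (g.curvature B C Z y) (V y)) x (A x) =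
        g.val x (g.nabla A (g.curvature B C Z) x) (V x) := by
    rw [g.mvfderiv_val hA.mdifferentiableAt_of_smooth
      (g.contMDiffAt_curvature hB hC hZ).mdifferentiableAt_of_smooth hV.mdifferentiableAt_of_smooth]
    simp [nabla, hV0]
  rw [key hX hY hW, key hY hW hX, key hW hX hY]
  have h := congrArg (fun u ↦ g.val x u (V x))
    (g.nabla_curvature_cyclic hX hY hW hZ hX0 hY0 hW0 hZ0)
  simpa using h

section Frame

variable {g} {ι : Type} [Fintype ι] [DecidableEq ι] {c c' : ι → Π x : M, TangentSpace 𝓘(ℝ, E) x}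

theorem IsDualFrame.eventually_ricci_eq_sum (hc : g.IsDualFrame x c c')
    (hY : ∀ᶠ y in 𝓝 x, CMDiffAt ∞ (T% Y) y) (hZ : ∀ᶠ y in 𝓝 x, CMDiffAt ∞ (T% Z) y) :
    ∀ᶠ y in 𝓝 x, g.ricci y (Y y) (Z y) =
      ∑ i, g.val y (g.curvature (c i) Y Z y) (c' i y) := by
  filter_upwards [hc.smooth, hc.dual, hY, hZ] with y h1 h2 h3 h4
  exact g.ricci_eq_sum h1 h2 h3 h4

theorem IsDualFrame.contMDiffAt_val_curvature (hc : g.IsDualFrame x c c')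
    (hY : CMDiffAt ∞ (T% Y) x) (hZ : CMDiffAt ∞ (T% Z) x) (i : ι) :
    CMDiffAt ∞ (fun y ↦ g.val y (g.curvature (c i) Y Z y) (c' i y)) x :=
  g.contMDiffAt_val (g.contMDiffAt_curvature (hc.smooth.self_of_nhds i) hY hZ)
    (hc.smooth'.self_of_nhds i)

theorem IsDualFrame.mvfderiv_ricci (hc : g.IsDualFrame x c c')
    (hY : ∀ᶠ y in 𝓝 x, CMDiffAt ∞ (T% Y) y) (hZ : ∀ᶠ y in 𝓝 x, CMDiffAt ∞ (T% Z) y)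
    (u : TangentSpace 𝓘(ℝ, E) x) :
    mvfderiv 𝓘(ℝ, E) (fun y ↦ g.ricci y (Y y) (Z y)) x u =
      ∑ i, mvfderiv 𝓘(ℝ, E) (fun y ↦ g.val y (g.curvature (c i) Y Z y) (c' i y)) x u := by
  rw [mvfderiv_congr_of_eventuallyEq (hc.eventually_ricci_eq_sum hY hZ), mvfderiv_sum]
  · simp
  · exact fun i _ ↦ (hc.contMDiffAt_val_curvature hY.self_of_nhds hZ.self_of_nhds i
      ).mdifferentiableAt (by simp)

theorem IsDualFrame.mdifferentiableAt_ricci (hc : g.IsDualFrame x c c')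
    (hY : ∀ᶠ y in 𝓝 x, CMDiffAt ∞ (T% Y) y) (hZ : ∀ᶠ y in 𝓝 x, CMDiffAt ∞ (T% Z) y) :
    MDiffAt (fun y ↦ g.ricci y (Y y) (Z y)) x := by
  refine MDifferentiableAt.congr_of_eventuallyEq (mdifferentiableAt_sum (s := Finset.univ)
    fun i _ ↦ ?_) (hc.eventually_ricci_eq_sum hY hZ)
  exact (hc.contMDiffAt_val_curvature hY.self_of_nhds hZ.self_of_nhds i
    ).mdifferentiableAt (by simp)

/-- The contracted second Bianchi identity `dr = 2 div S`, where `r` is the scalar curvature. -/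
theorem IsSynchronousFrame.mvfderiv_sum_ricci (hc : g.IsSynchronousFrame x c c')
    (hW : ∀ᶠ y in 𝓝 x, CMDiffAt ∞ (T% W) y) (hW0 : g.leviCivita W x = 0) :
    mvfderiv 𝓘(ℝ, E) (fun y ↦ ∑ j, g.ricci y (c j y) (c' j y)) x (W x) =
      2 * ∑ i, mvfderiv 𝓘(ℝ, E) (fun y ↦ g.ricci y (W y) (c' i y)) x (c i x) := by
  have hcs (i) : ∀ᶠ y in 𝓝 x, CMDiffAt ∞ (T% (c i)) y := hc.smooth.mono fun _ h ↦ h i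
  have hcs' (i) : ∀ᶠ y in 𝓝 x, CMDiffAt ∞ (T% (c' i)) y := hc.smooth'.mono fun _ h ↦ h i
  -- The divergence of `S(W, ·)` is the sum of the `F i j`.
  let F (i j : ι) : ℝ :=
    mvfderiv 𝓘(ℝ, E) (fun y ↦ g.val y (g.curvature (c j) W (c' i) y) (c' j y)) x (c i x)
  have key (i j : ι) :
      mvfderiv 𝓘(ℝ, E) (fun y ↦ g.val y (g.curvature (c i) (c j) (c' j) y) (c' i y)) x (W x) =
        F i j + F j i := by
    have h := g.mvfderiv_curvature_cyclic hW.self_of_nhds (hcs i).self_of_nhds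
      (hcs j).self_of_nhds (hcs' j).self_of_nhds (hcs' i).self_of_nhds hW0
      (hc.leviCivita_eq_zero i) (hc.leviCivita_eq_zero j) (hc.leviCivita_eq_zero' j)
      (hc.leviCivita_eq_zero' i)
    have h1 : mvfderiv 𝓘(ℝ, E) (fun y ↦ g.val y (g.curvature (c j) W (c' j) y) (c' i y)) x =
        - mvfderiv 𝓘(ℝ, E) (fun y ↦ g.val y (g.curvature (c j) W (c' i) y) (c' j y)) x := by
      rw [← mvfderiv_neg]
      refine mvfderiv_congr_of_eventuallyEq ?_
      filter_upwards [hW, hcs j, hcs' j, hcs' i] with y h1 h2 h3 h4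
      exact g.val_curvature_skew h2 h1 h3 h4
    have h2 : mvfderiv 𝓘(ℝ, E) (fun y ↦ g.val y (g.curvature W (c i) (c' j) y) (c' i y)) x =
        - mvfderiv 𝓘(ℝ, E) (fun y ↦ g.val y (g.curvature (c i) W (c' j) y) (c' i y)) x := by
      rw [← mvfderiv_neg]
      refine mvfderiv_congr_of_eventuallyEq (.of_forall fun y ↦ ?_)
      rw [curvature_swap]
      simp
    rw [h1, h2] at h
    simp only [neg_apply] at h
    simp only [F]
    linarith
  rw [mvfderiv_sum _ fun j _ ↦ hc.mdifferentiableAt_ricci (hcs j) (hcs' j)]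
  simp only [sum_apply, hc.mvfderiv_ricci (hcs _) (hcs' _), hc.mvfderiv_ricci hW (hcs' _), key,
    Finset.sum_add_distrib]
  rw [Finset.sum_comm (f := fun x_1 i ↦ F i x_1), two_mul]

/-! ### The Bochner formula -/

theorem IsDualFrame.eventually_laplacian_eq_sum (hc : g.IsDualFrame x c c') (f : M → ℝ) :
    ∀ᶠ y in 𝓝 x, g.laplacian f y =
      ∑ i, g.val y (g.nabla (c i) (g.gradient f) y) (c' i y) := by
  filter_upwards [hc.dual] with y h
  exact h.trace_eq _

theorem contMDiffAt_laplacian (hf : CMDiffAt ∞ f x) : CMDiffAt ∞ (g.laplacian f) x := by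
  obtain ⟨c, c', hc⟩ := g.exists_dualFrame x
  refine ContMDiffAt.congr_of_eventuallyEq (contMDiffAt_finsetSum fun i _ ↦ ?_)
    (hc.eventually_laplacian_eq_sum f)
  exact g.contMDiffAt_val (g.contMDiffAt_nabla (hc.smooth.self_of_nhds i)
    (g.contMDiffAt_gradient hf)) (hc.smooth'.self_of_nhds i)

/-- The divergence of `∇_W grad f`, which is the trace of `v ↦ ∇_v (∇_W grad f)`, in terms of the
Ricci tensor and the Laplacian of `f`. -/
theorem IsSynchronousFrame.sum_val_nabla_nabla_gradient (hc : g.IsSynchronousFrame x c c')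
    (hf : CMDiffAt ∞ f x) (hW : CMDiffAt ∞ (T% W) x) :
    ∑ i, g.val x (g.nabla (c i) (g.nabla W (g.gradient f)) x) (c' i x) =
      g.ricci x (W x) (g.gradient f x) + mvfderiv 𝓘(ℝ, E) (g.laplacian f) x (W x)
        + ∑ i, g.val x (g.leviCivita (g.gradient f) x (g.leviCivita W x (c i x))) (c' i x) := by
  have hξ := g.contMDiffAt_gradient hf
  have hcs := hc.smooth.self_of_nhds
  have hcs' := hc.smooth'.self_of_nhds
  have hd (i) : CMDiffAt ∞ (T% (g.nabla (c i) (g.gradient f))) x := g.contMDiffAt_nabla (hcs i) hξ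
  rw [g.ricci_eq_sum hcs hc.dual.self_of_nhds hW hξ,
    mvfderiv_congr_of_eventuallyEq (hc.eventually_laplacian_eq_sum f), mvfderiv_sum _ fun i _ ↦
      (g.contMDiffAt_val (hd i) (hcs' i)).mdifferentiableAt (by simp), sum_apply,
    ← Finset.sum_add_distrib, ← Finset.sum_add_distrib]
  refine Finset.sum_congr rfl fun i _ ↦ ?_
  have h1 : g.nabla (mlieBracket 𝓘(ℝ, E) (c i) W) (g.gradient f) x =
      g.leviCivita (g.gradient f) x (g.leviCivita W x (c i x)) := by
    rw [nabla, ← g.nabla_sub_nabla (hcs i).mdifferentiableAt_of_smooth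
      hW.mdifferentiableAt_of_smooth]
    simp [nabla, hc.leviCivita_eq_zero]
  rw [g.mvfderiv_val hW.mdifferentiableAt_of_smooth (hd i).mdifferentiableAt_of_smooth
    (hcs' i).mdifferentiableAt_of_smooth, curvature_eq, h1]
  simp [nabla, hc.leviCivita_eq_zero']
  ring

end Frame

/-- The symmetry of the Hessian, for tangent vectors. -/
theorem val_leviCivita_gradient_comm (hf : CMDiffAt ∞ f x) (v w : TangentSpace 𝓘(ℝ, E) x) :
    g.val x (g.leviCivita (g.gradient f) x v) w = g.val x (g.leviCivita (g.gradient f) x w) v := by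
  simpa [nabla] using g.val_nabla_gradient_comm hf (contMDiffAt_extend_smooth v)
    (contMDiffAt_extend_smooth w)

theorem mvfderiv_normSq (hX : CMDiffAt ∞ (T% X) x) (v : TangentSpace 𝓘(ℝ, E) x) :
    mvfderiv 𝓘(ℝ, E) (g.normSq X) x v = 2 * g.val x (g.leviCivita X x v) (X x) := by
  have h := g.mvfderiv_val (contMDiffAt_extend_smooth v).mdifferentiableAt_of_smooth
    hX.mdifferentiableAt_of_smooth hX.mdifferentiableAt_of_smooth
  simp only [nabla, extend_apply_self] at h
  rw [g.symm x (X x)] at h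
  exact h.trans (two_mul _).symm

/-- `grad |grad f|² = 2 ∇_{grad f} grad f`, by the symmetry of the Hessian. -/
theorem gradient_normSq_gradient (hf : ContMDiff 𝓘(ℝ, E) 𝓘(ℝ) ∞ f) :
    g.gradient (g.normSq (g.gradient f)) = (2 : ℝ) • g.nabla (g.gradient f) (g.gradient f) := by
  ext1 x
  refine g.ext_val fun u ↦ ?_
  rw [val_gradient, g.mvfderiv_normSq (g.contMDiffAt_gradient hf.contMDiffAt),
    g.val_leviCivita_gradient_comm hf.contMDiffAt]
  simp [nabla]

/-- The Bochner formula `½ Δ|grad f|² = |∇ grad f|² + S(grad f, grad f) + grad f (Δ f)`. -/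
theorem bochner (hf : ContMDiff 𝓘(ℝ, E) 𝓘(ℝ) ∞ f) (x : M) :
    (1 / 2 : ℝ) * g.laplacian (g.normSq (g.gradient f)) x =
      g.endNormSq x (g.leviCivita (g.gradient f) x)
        + g.ricci x (g.gradient f x) (g.gradient f x)
        + mvfderiv 𝓘(ℝ, E) (g.laplacian f) x (g.gradient f x) := by
  obtain ⟨c, c', hc⟩ := g.exists_isSynchronousFrame x
  have hξ := g.contMDiffAt_gradient (x := x) hf.contMDiffAt
  have hd := hc.dual.self_of_nhds
  have h1 : g.leviCivita (g.gradient (g.normSq (g.gradient f))) x =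
      (2 : ℝ) • g.leviCivita (g.nabla (g.gradient f) (g.gradient f)) x := by
    rw [g.gradient_normSq_gradient hf]
    exact g.leviCivita.isCovariantDerivativeOnUniv.smul_const 2
      (g.contMDiffAt_nabla hξ hξ).mdifferentiableAt_of_smooth
  have h2 := hc.sum_val_nabla_nabla_gradient hf.contMDiffAt hξ
  have h3 : ∑ i, g.val x (g.leviCivita (g.gradient f) x
      (g.leviCivita (g.gradient f) x (c i x))) (c' i x) =
      g.endNormSq x (g.leviCivita (g.gradient f) x) := by
    rw [hd.endNormSq_eq]
    refine Finset.sum_congr rfl fun i _ ↦ ?_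
    rw [g.val_leviCivita_gradient_comm hf.contMDiffAt, g.symm]
  rw [h3] at h2
  rw [laplacian, hd.trace_eq, h1, add_assoc, add_comm, ← h2, Finset.mul_sum]
  refine Finset.sum_congr rfl fun i _ ↦ ?_
  simp [nabla]

/-! ### Gradient almost `η`-Ricci solitons -/

section Soliton

variable {g} {lam mu : M → ℝ}

theorem contMDiffAt_normSq {X : Π x : M, TangentSpace 𝓘(ℝ, E) x} (hX : CMDiffAt ∞ (T% X) x) :
    CMDiffAt ∞ (g.normSq X) x :=
  g.contMDiffAt_val hX hX

theorem IsDualPair.sum_val_mul {ι : Type*} [Fintype ι] [DecidableEq ι]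
    {u u' : ι → TangentSpace 𝓘(ℝ, E) x} (h : g.IsDualPair x u u')
    (ℓ : TangentSpace 𝓘(ℝ, E) x →ₗ[ℝ] ℝ) (v : TangentSpace 𝓘(ℝ, E) x) :
    ∑ i, g.val x v (u' i) * ℓ (u i) = ℓ v := by
  conv_rhs => rw [← h.sum_repr v]
  simp

namespace IsGradientAlmostEtaRicciSoliton

theorem ricci_eq (h : g.IsGradientAlmostEtaRicciSoliton f lam mu) (v w : TangentSpace 𝓘(ℝ, E) x) :
    g.ricci x v w = -(g.val x (g.leviCivita (g.gradient f) x v) w + lam x * g.val x v w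
      + mu x * (g.val x (g.gradient f x) v * g.val x (g.gradient f x) w)) := by
  have := h.equation x v w
  rw [hessian] at this
  rw [val_gradient, val_gradient]
  linarith

/-- The scalar curvature of a soliton, from the trace of the soliton equation. -/
theorem sum_ricci_eq (h : g.IsGradientAlmostEtaRicciSoliton f lam mu) {ι : Type*} [Fintype ι]
    [DecidableEq ι] {u u' : ι → TangentSpace 𝓘(ℝ, E) x} (hu : g.IsDualPair x u u') :
    ∑ i, g.ricci x (u i) (u' i) = -(g.laplacian f x + Module.finrank ℝ E * lam x
      + mu x * g.normSq (g.gradient f) x) := by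
  have h1 : g.laplacian f x = ∑ i, g.val x (g.leviCivita (g.gradient f) x (u i)) (u' i) :=
    hu.trace_eq _
  have h2 : g.normSq (g.gradient f) x =
      ∑ i, g.val x (g.gradient f x) (u i) * g.val x (g.gradient f x) (u' i) := by
    rw [normSq, hu.val_eq_sum]
    simp [g.symm x (u _), mul_comm]
  simp only [h.ricci_eq, Finset.sum_neg_distrib, Finset.sum_add_distrib, ← Finset.mul_sum, ← h1,
    ← h2, hu.val_eq]
  simp [hu.card, mul_comm]

/-- The divergence of the soliton equation, evaluated at `grad f`, with the divergence of the Ricci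
tensor and the scalar curvature eliminated by the contracted second Bianchi identity. -/
theorem mvfderiv_laplacian (h : g.IsGradientAlmostEtaRicciSoliton f lam mu) (x : M) :
    mvfderiv 𝓘(ℝ, E) (g.laplacian f) x (g.gradient f x) =
      -2 * g.ricci x (g.gradient f x) (g.gradient f x)
        + (Module.finrank ℝ E - 2) * mvfderiv 𝓘(ℝ, E) lam x (g.gradient f x)
        - g.normSq (g.gradient f) x * mvfderiv 𝓘(ℝ, E) mu x (g.gradient f x)
        - 2 * mu x * g.laplacian f x * g.normSq (g.gradient f) x := by
  obtain ⟨c, c', hc⟩ := g.exists_isSynchronousFrame x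
  -- `W` replaces `grad f` where a field with value `grad f` and derivative `0` at `x` is needed.
  obtain ⟨W, hW, hWx, hW0⟩ := g.exists_extension_leviCivita_eq_zero (g.gradient f x)
  set ξ := g.gradient f with hξ
  have hf := h.contMDiff_potential.contMDiffAt (x := x)
  have hξs : CMDiffAt ∞ (T% ξ) x := g.contMDiffAt_gradient hf
  have hξ' := hξs.mdifferentiableAt_of_smooth
  have hl := h.contMDiff_lam.contMDiffAt (x := x) |>.mdifferentiableAt (by simp)
  have hm := h.contMDiff_mu.contMDiffAt (x := x) |>.mdifferentiableAt (by simp)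
  have hd := hc.dual.self_of_nhds
  have hΔ := (g.contMDiffAt_laplacian hf).mdifferentiableAt (by simp)
  have hN := (g.contMDiffAt_normSq hξs).mdifferentiableAt (by simp)
  have hWs := hW.self_of_nhds
  have hW' := hWs.mdifferentiableAt_of_smooth
  have hcd (i) := (hc.smooth.self_of_nhds i).mdifferentiableAt_of_smooth
  have hcd' (i) := (hc.smooth'.self_of_nhds i).mdifferentiableAt_of_smooth
  have hdW := (g.contMDiffAt_nabla hWs hξs).mdifferentiableAt_of_smooth
  -- The derivative of the scalar curvature along `W`.
  have h1 : mvfderiv 𝓘(ℝ, E) (fun y ↦ ∑ j, g.ricci y (c j y) (c' j y)) x (W x) =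
      -(mvfderiv 𝓘(ℝ, E) (g.laplacian f) x (ξ x)
        + Module.finrank ℝ E * mvfderiv 𝓘(ℝ, E) lam x (ξ x)
        + (mu x * mvfderiv 𝓘(ℝ, E) (g.normSq ξ) x (ξ x)
          + g.normSq ξ x * mvfderiv 𝓘(ℝ, E) mu x (ξ x))) := by
    have d1 : MDiffAt (fun y ↦ (Module.finrank ℝ E : ℝ) * lam y) x := mdifferentiableAt_const.mul hl
    have d2 : MDiffAt (fun y ↦ mu y * g.normSq ξ y) x := hm.mul hN
    have d3 : MDiffAt (fun y ↦ g.laplacian f y + Module.finrank ℝ E * lam y) x := hΔ.add d1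
    rw [mvfderiv_congr_of_eventuallyEq (hc.dual.mono fun y hy ↦ h.sum_ricci_eq hy),
      mvfderiv_fun_neg, mvfderiv_fun_add d3 d2, mvfderiv_fun_add hΔ d1,
      mvfderiv_fun_mul mdifferentiableAt_const hl, mvfderiv_fun_mul hm hN, mvfderiv_const, hWx]
    simp
  -- The divergence of the Ricci tensor.
  have h2 (i) : mvfderiv 𝓘(ℝ, E) (fun y ↦ g.ricci y (W y) (c' i y)) x (c i x) =
      -(g.val x (g.nabla (c i) (g.nabla W ξ) x) (c' i x)
        + g.val x (W x) (c' i x) * mvfderiv 𝓘(ℝ, E) lam x (c i x)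
        + (mu x * (g.val x (ξ x) (c' i x) * g.val x (g.leviCivita ξ x (c i x)) (W x)
          + g.val x (ξ x) (W x) * g.val x (g.leviCivita ξ x (c i x)) (c' i x))
          + g.val x (ξ x) (W x) * (g.val x (ξ x) (c' i x) * mvfderiv 𝓘(ℝ, E) mu x (c i x)))) := by
    have d1 := g.mdifferentiableAt_val hdW (hcd' i)
    have d2 := g.mdifferentiableAt_val hW' (hcd' i)
    have d3 := g.mdifferentiableAt_val hξ' hW'
    have d4 := g.mdifferentiableAt_val hξ' (hcd' i)
    have e : (fun y ↦ g.ricci y (W y) (c' i y)) = fun y ↦ -(g.val y (g.nabla W ξ y) (c' i y)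
        + lam y * g.val y (W y) (c' i y)
        + mu y * (g.val y (ξ y) (W y) * g.val y (ξ y) (c' i y))) := by
      ext y; exact h.ricci_eq _ _
    have d5 : MDiffAt (fun y ↦ lam y * g.val y (W y) (c' i y)) x := hl.mul d2
    have d6 : MDiffAt (fun y ↦ g.val y (ξ y) (W y) * g.val y (ξ y) (c' i y)) x := d3.mul d4
    have d7 : MDiffAt (fun y ↦ mu y * (g.val y (ξ y) (W y) * g.val y (ξ y) (c' i y))) x :=
      hm.mul d6
    have d8 : MDiffAt (fun y ↦ g.val y (g.nabla W ξ y) (c' i y)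
        + lam y * g.val y (W y) (c' i y)) x := d1.add d5
    rw [e, mvfderiv_fun_neg, mvfderiv_fun_add d8 d7, mvfderiv_fun_add d1 d5, mvfderiv_fun_mul hl d2,
      mvfderiv_fun_mul hm d6, mvfderiv_fun_mul d3 d4]
    simp only [neg_apply, add_apply, smul_apply, smul_eq_mul, g.mvfderiv_val (hcd i) hdW (hcd' i),
      g.mvfderiv_val (hcd i) hW' (hcd' i), g.mvfderiv_val (hcd i) hξ' hW',
      g.mvfderiv_val (hcd i) hξ' (hcd' i)]
    simp only [nabla, hc.leviCivita_eq_zero', hW0, zero_apply, map_zero, add_zero, mul_zero]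
    ring
  have h3 := hc.mvfderiv_sum_ricci hW hW0
  have h4 := hc.sum_val_nabla_nabla_gradient hf hWs
  simp only [← hξ, hW0, zero_apply, map_zero, Finset.sum_const_zero, add_zero] at h4
  have h5 : ∑ i, g.val x (W x) (c' i x) * mvfderiv 𝓘(ℝ, E) lam x (c i x) =
      mvfderiv 𝓘(ℝ, E) lam x (W x) := hd.sum_val_mul (mvfderiv 𝓘(ℝ, E) lam x).toLinearMap (W x)
  have h6 : ∑ i, g.val x (ξ x) (c' i x) * mvfderiv 𝓘(ℝ, E) mu x (c i x) =
      mvfderiv 𝓘(ℝ, E) mu x (ξ x) := hd.sum_val_mul (mvfderiv 𝓘(ℝ, E) mu x).toLinearMap (ξ x)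
  have h7 : ∑ i, g.val x (ξ x) (c' i x) * g.val x (g.leviCivita ξ x (c i x)) (W x) =
      g.val x (g.leviCivita ξ x (ξ x)) (W x) :=
    hd.sum_val_mul ((g.bilin x).flip (W x) ∘ₗ (g.leviCivita ξ x).toLinearMap) (ξ x)
  have h8 : g.laplacian f x = ∑ i, g.val x (g.leviCivita ξ x (c i x)) (c' i x) := hd.trace_eq _
  have h9 := g.mvfderiv_normSq hξs (ξ x)
  have h10 : g.normSq ξ x = g.val x (ξ x) (ξ x) := rfl
  simp only [h2, Finset.sum_neg_distrib, Finset.sum_add_distrib, ← Finset.mul_sum, h4, h5, h6, h7,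
    ← h8, h1] at h3
  rw [hWx, ← h10] at h3
  linear_combination h3 + mu x * h9

end IsGradientAlmostEtaRicciSoliton

end Soliton

end PseudoRiemannianMetric

end

theorem theorem4p2 {n : ℕ} {M : Type*} [TopologicalSpace M]
    [ChartedSpace (EuclideanSpace ℝ (Fin n)) M] [IsManifold (𝓡 n) ∞ M]
    (g : PseudoRiemannianMetric (𝓡 n) M) (f lam mu : M → ℝ)
    (hsol : g.IsGradientAlmostEtaRicciSoliton f lam mu)
    (ξ : Π x : M, TangentSpace (𝓡 n) x) (hξ : ξ = g.gradient f) (x : M) :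
    (1 / 2 : ℝ) * (g.laplacian (g.normSq ξ) x - mvfderiv (𝓡 n) (g.normSq ξ) x (ξ x)) =
      g.endNormSq x (g.leviCivita ξ x) + lam x * g.normSq ξ x
        + mu x * g.normSq ξ x * (g.normSq ξ x - 2 * g.laplacian f x)
        + ((n : ℝ) - 2) * mvfderiv (𝓡 n) lam x (ξ x)
        - g.normSq ξ x * mvfderiv (𝓡 n) mu x (ξ x) := by
  subst hξ
  have h1 := g.bochner hsol.contMDiff_potential x
  have h2 := hsol.mvfderiv_laplacian x
  have h3 := hsol.ricci_eq (g.gradient f x) (g.gradient f x)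
  have h4 := g.mvfderiv_normSq (g.contMDiffAt_gradient hsol.contMDiff_potential.contMDiffAt)
    (g.gradient f x)
  have h5 : g.normSq (g.gradient f) x = g.val x (g.gradient f x) (g.gradient f x) := rfl
  rw [finrank_euclideanSpace_fin] at h2
  rw [← h5] at h3
  linear_combination h1 + h2 - h3 - 1 / 2 * h4
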